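/- Let $d\ge 1$ and let the directed lattice $\mathbb{N}^d$ have an edge from $v$ to $v+e_k$ for each vertex $v$ and each unit vector $e_k$. Let $F$ be the distribution function of a real random variable $X$ such that $$\int_0^\infty (1-F(s))^{1/d}\,ds<\infty$$ and $\mathbb{E}[\max(-X,0)]<\infty$ (the latter is automatic when rewards are non-negative). Let the rewards $(r(v))_{v\in\mathbb{N}^d}$ be i.i.d. with distribution $F$. For a vertex $v$ and $n\in\mathbb{N}$ let $$T(v,n)=\max_{\pi}\ \sum_{i=1}^{n} r(\pi_i),$$ the maximum being over all directed paths $\pi=(\pi_0,\pi_1,\dots,\pi_n)$ with $\pi_0=v$. Iterative planner with sensing range $m$: start at $v_0=0$. In iteration $k=1,2,\dots$, observe the rewards of the vertices reachable from $v_{k-1}$ in at most $m$ steps, choose a path with $m$ steps from $v_{k-1}$ that attains $T_k:=T(v_{k-1},m)$ (ties are broken by an arbitrary measurable rule depending only on $v_{k-1}$ and the observed rewards), and let $v_k$ be the end of this path. The mean reward of the planner over distance $n$ is $$R_{\mathrm{iter}}(n;m)=\frac1n\sum_{k=1}^{\lfloor n/m\rfloor}T_k .$$ Then every $T(0,n)$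 is integrable, the limit $R^*_d:=\lim_{n\to\infty}\mathbb{E}[T(0,n)]/n$ exists and is finite, and there is a constant $c>0$, depending only on $d$ and $F$, such that $R_{\mathrm{iter}}(n;\lfloor c\log n\rfloor)$ converges to $R^*_d$ in probability as $n\to\infty$: for every $\delta>0$, $$\lim_{n\to\infty}\mathbb{P}\big(\,|R_{\mathrm{iter}}(n;\lfloor c\log n\rfloor)-R^*_d|\ge\delta\,\big)=0 .$$ This holds whichever tie-breaking rule is used for each sensing range, with the same $c$. -/

import Mathlib

open MeasureTheory ProbabilityTheory Filter Topology

universe u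

namespace LatticePlanning

/-- Vertices of the `d`-dimensional directed regular lattice. -/
abbrev Vertex (d : ℕ) : Type := Fin d → ℕ

/-- There is an edge from `v` to `w` iff `w` is `v` with exactly one coordinate increased by `1`. -/
def Edge {d : ℕ} (v w : Vertex d) : Prop :=
  ∃ k : Fin d, w = Function.update v k (v k + 1)

/-- The paths that start at `v` and cross `n` vertices after leaving `v` (that is, make `n` steps). -/
def paths {d : ℕ} (v : Vertex d) (n : ℕ) : Set (Fin (n + 1) → Vertex d) :=
  {p | p 0 = v ∧ ∀ i : Fin n, Edge (p i.castSucc) (p i.succ)}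

/-- The reward collected along a path: the sum of the rewards of the vertices it crosses after
leaving its starting vertex. -/
noncomputable def pathReward {d n : ℕ} (ρ : Vertex d → ℝ) (p : Fin (n + 1) → Vertex d) : ℝ :=
  ∑ i : Fin n, ρ (p i.succ)

/-- The maximum total reward of a path with `n` steps from `v`. For `0 < d` the supremum is a
maximum over a nonempty finite set, see `isGreatest_maxReward`. -/
noncomputable def maxReward {d : ℕ} (ρ : Vertex d → ℝ) (v : Vertex d) (n : ℕ) : ℝ :=
  sSup (pathReward ρ '' paths v n)

theorem paths_finite {d : ℕ} (v : Vertex d) (n : ℕ) : (paths v n).Finite := by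
  have key : ∀ p ∈ paths v n, ∀ i : ℕ, ∀ hi : i < n + 1,
      v ≤ p ⟨i, hi⟩ ∧ p ⟨i, hi⟩ ≤ fun j => v j + i := by
    rintro p ⟨h0, hp⟩ i
    induction i with
    | zero =>
      intro hi
      have : p ⟨0, hi⟩ = v := h0
      rw [this]
      exact ⟨le_rfl, fun j => by simp⟩
    | succ i ih =>
      intro hi
      obtain ⟨h1, h2⟩ := ih (by omega)
      obtain ⟨k, hk⟩ := hp ⟨i, by omega⟩
      have e1 : (⟨i, by omega⟩ : Fin n).castSucc = ⟨i, by omega⟩ := rfl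
      have e2 : (⟨i, by omega⟩ : Fin n).succ = ⟨i + 1, hi⟩ := rfl
      rw [e1, e2] at hk
      rw [hk]
      refine ⟨fun j => ?_, fun j => ?_⟩
      · have : v j ≤ p ⟨i, by omega⟩ j := h1 j
        by_cases hj : j = k
        · subst hj; simp; omega
        · simp [hj, this]
      · have := h2 j
        by_cases hj : j = k
        · subst hj; simp at this ⊢; omega
        · simp [hj] at this ⊢; omega
  refine Set.Finite.subset
    (Set.Finite.pi' (fun _ : Fin (n + 1) => Set.finite_Icc v (fun j => v j + n))) ?_
  intro p hp i
  obtain ⟨h1, h2⟩ := key p hp i.1 i.2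
  exact ⟨h1, h2.trans fun j => by have := i.2; simp; omega⟩

theorem paths_nonempty {d : ℕ} (hd : 0 < d) (v : Vertex d) (n : ℕ) : (paths v n).Nonempty := by
  refine ⟨fun i => Function.update v ⟨0, hd⟩ (v ⟨0, hd⟩ + i), by simp, fun i => ⟨⟨0, hd⟩, ?_⟩⟩
  simp [add_assoc]

theorem isGreatest_maxReward {d : ℕ} (hd : 0 < d) (ρ : Vertex d → ℝ) (v : Vertex d) (n : ℕ) :
    IsGreatest (pathReward ρ '' paths v n) (maxReward ρ v n) := by
  have hf := (paths_finite v n).image (pathReward ρ)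
  have hn := (paths_nonempty hd v n).image (pathReward ρ)
  exact ⟨hn.csSup_mem hf, fun x hx => le_csSup hf.bddAbove hx⟩

/-- The optimal mean reward (unlimited sensing range): the limit of `𝔼[T(n)] / n`, where `T(n)` is
the maximum total reward of a path with `n` steps from the origin. -/
noncomputable def optimalMeanReward {d : ℕ} {Ω : Type*} [MeasurableSpace Ω]
    (P : Measure Ω) (r : Vertex d → Ω → ℝ) : ℝ :=
  limUnder atTop fun n : ℕ => (∫ ω, maxReward (fun v => r v ω) 0 n ∂P) / n

/-- One planning iteration with sensing range `m`: from the current vertex `v` and the rewards of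
the vertices at distance at most `m` reachable from `v`, compute a maximum-reward path with `m`
steps. Ties between maximum-reward paths are broken by an arbitrary measurable rule. -/
structure Planner (d m : ℕ) where
  plan : Vertex d → (Vertex d → ℝ) → (Fin (m + 1) → Vertex d)
  plan_mem : ∀ v ρ, plan v ρ ∈ paths v m
  plan_max : ∀ v ρ, ∀ p ∈ paths v m, pathReward ρ p ≤ pathReward ρ (plan v ρ)
  plan_visible : ∀ v ρ ρ',
    (∀ w : Vertex d, v ≤ w → ∑ j, w j ≤ ∑ j, v j + m → ρ w = ρ' w) → plan v ρ = plan v ρ'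
  measurable_plan : ∀ v, Measurable (plan v)

/-- The vertex reached after `k` iterations: start at the origin, and in each iteration follow the
planned path to its end. -/
def Planner.position {d m : ℕ} (A : Planner d m) (ρ : Vertex d → ℝ) : ℕ → Vertex d
  | 0 => 0
  | k + 1 => A.plan (A.position ρ k) ρ (Fin.last m)

/-- The mean reward of the iterative planner over a distance `n`: it performs `⌊n / m⌋` iterations,
and the iteration that starts at `v` collects the maximum reward of a path with `m` steps from `v`. -/
noncomputable def Planner.meanReward {d m : ℕ} (A : Planner d m) (ρ : Vertex d → ℝ) (n : ℕ) : ℝ :=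
  (∑ k ∈ Finset.range (n / m), maxReward ρ (A.position ρ k) m) / n

theorem pathReward_congr {d m : ℕ} {v : Vertex d} {ρ ρ' : Vertex d → ℝ}
    (h : ∀ w : Vertex d, v ≤ w → ∑ j, w j ≤ ∑ j, v j + m → ρ w = ρ' w)
    {p : Fin (m + 1) → Vertex d} (hp : p ∈ paths v m) : pathReward ρ p = pathReward ρ' p := by
  have key : ∀ i : ℕ, ∀ hi : i < m + 1, v ≤ p ⟨i, hi⟩ ∧ ∑ j, p ⟨i, hi⟩ j = ∑ j, v j + i := by
    obtain ⟨h0, hp⟩ := hp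
    intro i
    induction i with
    | zero =>
      intro hi
      have : p ⟨0, hi⟩ = v := h0
      rw [this]
      exact ⟨le_rfl, by simp⟩
    | succ i ih =>
      intro hi
      obtain ⟨h1, h2⟩ := ih (by omega)
      obtain ⟨k, hk⟩ := hp ⟨i, by omega⟩
      have e1 : (⟨i, by omega⟩ : Fin m).castSucc = ⟨i, by omega⟩ := rfl
      have e2 : (⟨i, by omega⟩ : Fin m).succ = ⟨i + 1, hi⟩ := rfl
      rw [e1, e2] at hk
      rw [hk]
      refine ⟨fun j => ?_, ?_⟩
      · have : v j ≤ p ⟨i, by omega⟩ j := h1 j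
        by_cases hj : j = k
        · subst hj; simp; omega
        · simp [hj, this]
      · rw [Finset.sum_update_of_mem (Finset.mem_univ k)]
        rw [← Finset.add_sum_erase _ _ (Finset.mem_univ k)] at h2
        rw [Finset.sdiff_singleton_eq_erase]
        omega
  refine Finset.sum_congr rfl fun i _ => ?_
  obtain ⟨h1, h2⟩ := key i.succ.1 i.succ.2
  exact h _ h1 (by rw [h2]; have := i.succ.2; omega)

/-- Planners exist for every sensing range. -/
theorem planner_nonempty {d : ℕ} (hd : 0 < d) (m : ℕ) : Nonempty (Planner d m) := by
  classical
  let B : Vertex d → (Vertex d → ℝ) → Finset (Fin (m + 1) → Vertex d) := fun v ρ =>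
    (paths_finite v m).toFinset.filter fun p => ∀ q ∈ paths v m, pathReward ρ q ≤ pathReward ρ p
  let g : Finset (Fin (m + 1) → Vertex d) → (Fin (m + 1) → Vertex d) := fun S =>
    if h : S.Nonempty then h.choose else fun _ => 0
  have hB : ∀ v ρ, (B v ρ).Nonempty := by
    intro v ρ
    obtain ⟨p, hp, hmax⟩ := (isGreatest_maxReward hd ρ v m).1
    refine ⟨p, ?_⟩
    simp only [B, Finset.mem_filter, Set.Finite.mem_toFinset]
    exact ⟨hp, fun q hq => hmax ▸ (isGreatest_maxReward hd ρ v m).2 ⟨q, hq, rfl⟩⟩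
  have hg : ∀ v ρ, g (B v ρ) ∈ paths v m ∧
      ∀ q ∈ paths v m, pathReward ρ q ≤ pathReward ρ (g (B v ρ)) := by
    intro v ρ
    have h : g (B v ρ) ∈ B v ρ := by
      simp only [g, dif_pos (hB v ρ)]
      exact (hB v ρ).choose_spec
    simpa only [B, Finset.mem_filter, Set.Finite.mem_toFinset] using h
  refine ⟨⟨fun v ρ => g (B v ρ), fun v ρ => (hg v ρ).1, fun v ρ => (hg v ρ).2, ?_, ?_⟩⟩
  · intro v ρ ρ' h
    have : B v ρ = B v ρ' := by
      ext p
      simp only [B, Finset.mem_filter, Set.Finite.mem_toFinset]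
      refine and_congr_right fun hp => forall₂_congr fun q hq => ?_
      rw [pathReward_congr h hp, pathReward_congr h hq]
    simp only [this]
  · intro v
    let _ : MeasurableSpace (Finset (Fin (m + 1) → Vertex d)) := ⊤
    have hmeas : ∀ q : Fin (m + 1) → Vertex d,
        Measurable fun ρ : Vertex d → ℝ => pathReward ρ q := by
      intro q
      unfold pathReward
      fun_prop
    have hBm : Measurable (B v) := by
      refine measurable_to_countable' fun S => ?_
      have : B v ⁻¹' {S} = {ρ | ∀ p : Fin (m + 1) → Vertex d, p ∈ B v ρ ↔ p ∈ S} := by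
        ext ρ
        simp [Finset.ext_iff]
      rw [this, Set.ofPred_forall]
      refine MeasurableSet.iInter fun p => ?_
      have h1 : MeasurableSet {ρ | p ∈ B v ρ} := by
        have : {ρ | p ∈ B v ρ} = {_ρ : Vertex d → ℝ | p ∈ paths v m} ∩
            ⋂ q ∈ paths v m, {ρ | pathReward ρ q ≤ pathReward ρ p} := by
          ext ρ
          simp [B]
        rw [this]
        exact (MeasurableSet.const _).inter (MeasurableSet.biInter (Set.to_countable _)
          fun q _ => measurableSet_le (hmeas q) (hmeas p))
      exact h1.iff (MeasurableSet.const _)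
    exact (measurable_from_top (f := g)).comp hBm

end LatticePlanning

/-! By Markov's inequality, convergence in L¹ suffices, and for the planner it reduces to one
iteration. The mean reward is, up to an error |R|·m/n, an average of the terms `T_k / m`, each
distributed as `T(0,m)/m`. The triangle inequality bounds its L¹ error by that of a single block, so
it is enough that m → ∞, m/n → 0 and `T(0,m)/m → R` in L¹; no concentration estimate enters.

The reward of the starting vertex is not collected. Hence, from a vertex chosen by looking only at
earlier layers, the field is a fresh copy (`lintegral_mul_shift_of_dependsOn`); blocks are
identically distributed and pairwise independent, and 𝔼 T(0,n) is superadditive.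

A linear upper bound on 𝔼 T(0,n) makes the limit R finite (Fekete). Cutting rewards at levels s
reduces it to the largest number of vertices above s on a path, whose mean is O(n p^{1/d}) with p =
1 - F(s) (`lintegral_maxCount_le`); integrating over s gives the tail hypothesis. The marked
vertices of a path form a chain with 2^c subchains, so c is at most logarithmic in the weight of all
marked chains, whose expectation is bounded recursively.

For L¹ convergence, T(0,m) dominates the rewards of a planner with fixed range k, which the strong
law brings near R·m. So `T(0,m)/m - R` has small negative part, and its mean tends to zero. -/

namespace LatticePlanning

open scoped ENNReal

/-! ### Independence of disjoint sets of coordinates, and the shifted field -/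

/-- A measurable function that depends only on the coordinates in `S` is measurable with respect to
the σ-algebra generated by these coordinates. -/
theorem measurable_iSup_comap_of_dependsOn {ι β : Type*} [MeasurableSpace β] {S : Set ι}
    {f : (ι → ℝ) → β} (hf : Measurable f) (hS : DependsOn f S) :
    Measurable[⨆ i ∈ S, MeasurableSpace.comap (fun ρ : ι → ℝ => ρ i) inferInstance] f := by
  classical
  -- Zeroing the coordinates outside `S` does not change `f`, and is measurable for the smaller
  -- σ-algebra.
  have hfac : f = f ∘ fun ρ i => if i ∈ S then ρ i else 0 := by
    funext ρ
    exact hS fun i hi => by simp [hi]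
  rw [hfac]
  refine hf.comp ?_
  refine @measurable_pi_lambda _ _ _ (_) _ _ fun i => ?_
  by_cases hi : i ∈ S
  · simp only [hi, if_true]
    have : Measurable[MeasurableSpace.comap (fun ρ : ι → ℝ => ρ i) inferInstance]
        fun ρ : ι → ℝ => ρ i := comap_measurable _
    exact this.mono (le_iSup₂_of_le i hi le_rfl) le_rfl
  · simp only [hi, if_false]
    exact @measurable_const _ _ _ (_) _

/-- Functions of disjoint sets of independent coordinates are uncorrelated. -/
theorem lintegral_mul_of_dependsOn_disjoint {ι : Type*} (μ : Measure ℝ) [IsProbabilityMeasure μ]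
    {S T : Set ι} (hST : Disjoint S T) {f g : (ι → ℝ) → ℝ≥0∞} (hf : Measurable f)
    (hg : Measurable g) (hfS : DependsOn f S) (hgT : DependsOn g T) :
    ∫⁻ ρ, f ρ * g ρ ∂(Measure.infinitePi fun _ : ι => μ) =
      (∫⁻ ρ, f ρ ∂(Measure.infinitePi fun _ : ι => μ)) *
        ∫⁻ ρ, g ρ ∂(Measure.infinitePi fun _ : ι => μ) := by
  have hle : ∀ i : ι, MeasurableSpace.comap (fun ρ : ι → ℝ => ρ i) inferInstance ≤
      (inferInstance : MeasurableSpace (ι → ℝ)) := fun i => (measurable_pi_apply i).comap_le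
  have hind : iIndepFun (fun (i : ι) (ρ : ι → ℝ) => ρ i)
      (Measure.infinitePi fun _ : ι => μ) :=
    iIndepFun_infinitePi (P := fun _ : ι => μ) (X := fun _ x => x) (fun _ => measurable_id)
  exact lintegral_mul_eq_lintegral_mul_lintegral_of_independent_measurableSpace
    (iSup₂_le fun i _ => hle i) (iSup₂_le fun i _ => hle i)
    (indep_iSup_of_disjoint hle hind hST)
    (measurable_iSup_comap_of_dependsOn hf hfS) (measurable_iSup_comap_of_dependsOn hg hgT)

/-- The field of rewards seen from the vertex `v`. -/
def shift {d : ℕ} (v : Vertex d) (ρ : Vertex d → ℝ) : Vertex d → ℝ := fun w => ρ (v + w)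

theorem measurable_shift {d : ℕ} (v : Vertex d) : Measurable (shift v) := by
  unfold shift; fun_prop

theorem map_shift_infinitePi {d : ℕ} (μ : Measure ℝ) [IsProbabilityMeasure μ] (v : Vertex d) :
    (Measure.infinitePi fun _ : Vertex d => μ).map (shift v) =
      Measure.infinitePi fun _ : Vertex d => μ := by
  have hind : iIndepFun (fun (i : Vertex d) (ρ : Vertex d → ℝ) => ρ i)
      (Measure.infinitePi fun _ : Vertex d => μ) :=
    iIndepFun_infinitePi (P := fun _ : Vertex d => μ) (X := fun _ x => x) (fun _ => measurable_id)
  have h := (hind.precomp (add_right_injective v)).map_fun_eq_infinitePi_map (by fun_prop)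
  have h2 : ∀ i : Vertex d, (Measure.infinitePi fun _ : Vertex d => μ).map (fun ρ => ρ (v + i)) = μ :=
    fun i => Measure.infinitePi_map_eval (fun _ : Vertex d => μ) (v + i)
  simp only [h2] at h
  exact h

/-- The vertices up to level `L`. -/
def layersUpTo (d L : ℕ) : Set (Vertex d) := {w | ∑ j, w j ≤ L}

/-- If `V` is a vertex of level `L` chosen on the basis of the layers up to `L`, the field of rewards
at the nonzero vertices seen from `V` is independent of these layers and distributed as the field
seen from the origin. -/
theorem lintegral_mul_shift_of_dependsOn {d L : ℕ} (μ : Measure ℝ) [IsProbabilityMeasure μ]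
    {V : (Vertex d → ℝ) → Vertex d} (hV : Measurable V) (hVL : ∀ ρ, ∑ j, V ρ j = L)
    (hVdep : DependsOn V (layersUpTo d L)) {f g : (Vertex d → ℝ) → ℝ≥0∞} (hf : Measurable f)
    (hg : Measurable g) (hgdep : DependsOn g (layersUpTo d L)) (hfdep : DependsOn f {0}ᶜ) :
    ∫⁻ ρ, g ρ * f (shift (V ρ) ρ) ∂(Measure.infinitePi fun _ : Vertex d => μ) =
      (∫⁻ ρ, g ρ ∂(Measure.infinitePi fun _ : Vertex d => μ)) *
        ∫⁻ ρ, f ρ ∂(Measure.infinitePi fun _ : Vertex d => μ) := by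
  classical
  set Q := Measure.infinitePi fun _ : Vertex d => μ
  have hm : ∀ v, Measurable fun ρ => if V ρ = v then g ρ else 0 := fun v =>
    Measurable.ite (hV (measurableSet_singleton v)) hg measurable_const
  -- Splitting over the countably many values of `V` makes the shift deterministic.
  have hsplit : ∀ h : (Vertex d → ℝ) → Vertex d → ℝ≥0∞, ∀ ρ,
      g ρ * h ρ (V ρ) = ∑' v, (if V ρ = v then g ρ else 0) * h ρ v := by
    intro h ρ
    rw [tsum_eq_single (V ρ) (fun v hv => by simp [hv.symm])]
    simp
  have hterm : ∀ v, ∫⁻ ρ, (if V ρ = v then g ρ else 0) * f (shift v ρ) ∂Q =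
      (∫⁻ ρ, (if V ρ = v then g ρ else 0) ∂Q) * ∫⁻ ρ, f ρ ∂Q := by
    intro v
    by_cases hv : ∑ j, v j = L
    · have hdisj : Disjoint (layersUpTo d L) (layersUpTo d L)ᶜ := disjoint_compl_right
      have key := lintegral_mul_of_dependsOn_disjoint μ hdisj (hm v)
        (g := fun ρ => f (shift v ρ)) (hf.comp (measurable_shift v)) ?_ ?_
      · rw [key, ← lintegral_map hf (measurable_shift v), map_shift_infinitePi]
      · intro x y hxy
        simp only [hVdep hxy, hgdep hxy]
      · intro x y hxy
        refine hfdep fun w hw => hxy _ ?_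
        simp only [layersUpTo, Set.mem_compl_iff, Set.mem_ofPred_eq, not_le, Pi.add_apply,
          Finset.sum_add_distrib, hv]
        -- The vertex `v` itself lies on level `L`; only because `f` ignores the origin does it see
        -- nothing but higher levels.
        have : ∑ j, w j ≠ 0 := by
          intro h0
          apply hw
          funext j
          exact (Finset.sum_eq_zero_iff.1 h0) j (Finset.mem_univ j)
        omega
    · have : ∀ ρ, V ρ ≠ v := fun ρ h => hv (h ▸ hVL ρ)
      simp [this]
  calc ∫⁻ ρ, g ρ * f (shift (V ρ) ρ) ∂Q
      = ∫⁻ ρ, ∑' v, (if V ρ = v then g ρ else 0) * f (shift v ρ) ∂Q := by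
        simp_rw [hsplit fun ρ v => f (shift v ρ)]
    _ = ∑' v, ∫⁻ ρ, (if V ρ = v then g ρ else 0) * f (shift v ρ) ∂Q :=
        lintegral_tsum fun v => ((hm v).mul (hf.comp (measurable_shift v))).aemeasurable
    _ = ∑' v, (∫⁻ ρ, (if V ρ = v then g ρ else 0) ∂Q) * ∫⁻ ρ, f ρ ∂Q := by simp_rw [hterm]
    _ = (∫⁻ ρ, g ρ ∂Q) * ∫⁻ ρ, f ρ ∂Q := by
        rw [ENNReal.tsum_mul_right, ← lintegral_tsum fun v => (hm v).aemeasurable]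
        congr 2
        funext ρ
        simpa only [mul_one] using (hsplit (fun _ _ => 1) ρ).symm

/-! ### Paths as sequences: concatenation, translation, measurability -/

section Paths

variable {d : ℕ}

/-- A path given by the first `n` steps of a sequence. -/
theorem pathReward_le_of_seq {ρ : Vertex d → ℝ} {n : ℕ} {q : ℕ → Vertex d}
    (hq : ∀ i < n, Edge (q i) (q (i + 1))) :
    ∑ i ∈ Finset.range n, ρ (q (i + 1)) ≤ maxReward ρ (q 0) n := by
  refine le_csSup ((paths_finite _ _).image _).bddAbove
    ⟨fun i => q i, ⟨rfl, fun i => hq i i.2⟩, ?_⟩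
  simp [pathReward, Finset.sum_range]

/-- Every path is given by a sequence. -/
theorem exists_seq_of_mem_paths {v : Vertex d} {n : ℕ}
    {p : Fin (n + 1) → Vertex d} (hp : p ∈ paths v n) :
    ∃ q : ℕ → Vertex d, q 0 = v ∧ q n = p (Fin.last n) ∧ (∀ i < n, Edge (q i) (q (i + 1))) ∧
      ∀ i : Fin (n + 1), q i = p i := by
  refine ⟨fun i => p ⟨min i n, by omega⟩, ?_, ?_, fun i hi => ?_, fun i => ?_⟩
  · simpa using hp.1
  · exact congrArg p (Fin.ext (min_self n))
  · have := hp.2 ⟨i, hi⟩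
    convert this using 2
    · ext; simp; omega
    · ext; simp; omega
  · exact congrArg p (Fin.ext (min_eq_left (Nat.le_of_lt_succ i.2)))

theorem pathReward_eq_sum_seq (ρ : Vertex d → ℝ) {n : ℕ} {p : Fin (n + 1) → Vertex d}
    {q : ℕ → Vertex d} (h : ∀ i : Fin (n + 1), q i = p i) :
    pathReward ρ p = ∑ i ∈ Finset.range n, ρ (q (i + 1)) := by
  rw [Finset.sum_range, pathReward]
  refine Finset.sum_congr rfl fun i _ => ?_
  rw [← h i.succ]
  rfl

theorem edge_sum {v w : Vertex d} (h : Edge v w) : ∑ j, w j = ∑ j, v j + 1 := by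
  classical
  obtain ⟨k, rfl⟩ := h
  rw [Finset.sum_update_of_mem (Finset.mem_univ k), ← Finset.add_sum_erase _ v (Finset.mem_univ k),
    Finset.sdiff_singleton_eq_erase]
  ring

theorem edge_lt {v w : Vertex d} (h : Edge v w) : v < w := by
  obtain ⟨k, rfl⟩ := h
  simp

theorem seq_sum {q : ℕ → Vertex d} {n : ℕ} (hq : ∀ i < n, Edge (q i) (q (i + 1))) :
    ∀ i ≤ n, ∑ j, q i j = ∑ j, q 0 j + i := by
  intro i hi
  induction i with
  | zero => simp
  | succ i ih => rw [edge_sum (hq i (by omega)), ih (by omega)]; ring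

theorem seq_le {q : ℕ → Vertex d} {n : ℕ} (hq : ∀ i < n, Edge (q i) (q (i + 1))) :
    ∀ i ≤ n, q 0 ≤ q i := by
  intro i hi
  induction i with
  | zero => exact le_rfl
  | succ i ih => exact (ih (by omega)).trans (edge_lt (hq i (by omega))).le

/-- Two paths can be concatenated. -/
theorem exists_concat_seq (ρ : Vertex d → ℝ) {n m : ℕ} {q s : ℕ → Vertex d}
    (hq : ∀ i < n, Edge (q i) (q (i + 1))) (hs0 : s 0 = q n)
    (hs : ∀ i < m, Edge (s i) (s (i + 1))) :
    ∃ q' : ℕ → Vertex d, q' 0 = q 0 ∧ q' (n + m) = s m ∧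
      (∀ i < n + m, Edge (q' i) (q' (i + 1))) ∧
      ∑ i ∈ Finset.range (n + m), ρ (q' (i + 1)) =
        ∑ i ∈ Finset.range n, ρ (q (i + 1)) + ∑ i ∈ Finset.range m, ρ (s (i + 1)) := by
  obtain ⟨q', hq'⟩ : ∃ q' : ℕ → Vertex d, ∀ i, q' i = if i ≤ n then q i else s (i - n) :=
    ⟨_, fun _ => rfl⟩
  have h1 : ∀ i ≤ n, q' i = q i := fun i hi => by rw [hq', if_pos hi]
  have h2 : ∀ i, q' (n + i) = s i := by
    intro i
    rcases Nat.eq_zero_or_pos i with rfl | h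
    · rw [add_zero, h1 n le_rfl, hs0]
    · rw [hq', if_neg (by omega), Nat.add_sub_cancel_left]
  refine ⟨q', h1 0 (Nat.zero_le n), h2 m, fun i hi => ?_, ?_⟩
  · by_cases h : i < n
    · rw [h1 i h.le, h1 (i + 1) h]
      exact hq i h
    · obtain ⟨j, rfl⟩ := Nat.exists_eq_add_of_le (not_lt.1 h)
      rw [h2, add_assoc, h2]
      exact hs j (by omega)
  · rw [Finset.sum_range_add]
    congr 1
    · exact Finset.sum_congr rfl fun i hi => by rw [h1 _ (Finset.mem_range.1 hi)]
    · exact Finset.sum_congr rfl fun i hi => by rw [add_assoc, h2]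

theorem maxReward_eq_shift (ρ : Vertex d → ℝ) (v : Vertex d) (m : ℕ) :
    maxReward ρ v m = maxReward (shift v ρ) 0 m := by
  unfold maxReward
  congr 1
  ext x
  constructor
  · rintro ⟨p, hp, rfl⟩
    obtain ⟨q, hq0, -, hq, hqp⟩ := exists_seq_of_mem_paths hp
    have hle := seq_le hq
    rw [hq0] at hle
    have hadd : ∀ i ≤ m, v + (q i - v) = q i := fun i hi => add_tsub_cancel_of_le (hle i hi)
    refine ⟨fun i => q i - v, ⟨by simp [hq0], fun i => ?_⟩, ?_⟩
    · obtain ⟨k, hk⟩ := hq i i.2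
      refine ⟨k, ?_⟩
      have h2 := hle i i.2.le
      simp only [Fin.val_succ, Fin.val_castSucc]
      funext j
      have h3 : v j ≤ q i j := h2 j
      rw [hk]
      by_cases hj : j = k
      · subst hj; simp; omega
      · simp [hj]
    · rw [pathReward_eq_sum_seq ρ hqp, pathReward, Finset.sum_range]
      refine Finset.sum_congr rfl fun i _ => ?_
      simp only [shift, Fin.val_succ, hadd _ (Nat.succ_le_of_lt i.2)]
  · rintro ⟨p, hp, rfl⟩
    refine ⟨fun i => v + p i, ⟨by simp [hp.1], fun i => ?_⟩, rfl⟩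
    obtain ⟨k, hk⟩ := hp.2 i
    refine ⟨k, ?_⟩
    funext j
    simp only [hk]
    by_cases hj : j = k
    · subst hj; simp [add_assoc]
    · simp [hj]

theorem maxReward_congr {m : ℕ} {v : Vertex d} {ρ ρ' : Vertex d → ℝ}
    (h : ∀ w : Vertex d, v < w → ∑ j, w j ≤ ∑ j, v j + m → ρ w = ρ' w) :
    maxReward ρ v m = maxReward ρ' v m := by
  unfold maxReward
  congr 1
  refine Set.image_congr fun p hp => ?_
  obtain ⟨q, hq0, -, hq, hqp⟩ := exists_seq_of_mem_paths hp
  rw [pathReward_eq_sum_seq ρ hqp, pathReward_eq_sum_seq ρ' hqp]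
  refine Finset.sum_congr rfl fun i hi => h _ ?_ ?_
  · have := seq_le hq i (Finset.mem_range.1 hi).le
    rw [hq0] at this
    exact this.trans_lt (edge_lt (hq i (Finset.mem_range.1 hi)))
  · rw [seq_sum hq _ (Finset.mem_range.1 hi), hq0]
    have := Finset.mem_range.1 hi
    omega

theorem measurable_maxReward (v : Vertex d) (m : ℕ) :
    Measurable fun ρ : Vertex d → ℝ => maxReward ρ v m := by
  unfold maxReward
  simp only [sSup_image']
  have := (paths_finite v m).to_subtype
  refine Measurable.iSup fun p => ?_
  unfold pathReward
  fun_prop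

theorem dependsOn_maxReward_zero (m : ℕ) :
    DependsOn (fun ρ : Vertex d → ℝ => maxReward ρ 0 m) {0}ᶜ :=
  fun _ _ h => maxReward_congr fun w hw _ => h w hw.ne'

end Paths

/-! ### Blocks of the planner: identical laws and pairwise independence -/

section Planner

variable {d m : ℕ} (A : Planner d m)

theorem Planner.position_sum (ρ : Vertex d → ℝ) (k : ℕ) : ∑ j, A.position ρ k j = k * m := by
  induction k with
  | zero => simp [Planner.position]
  | succ k ih =>
    obtain ⟨q, hq0, hqm, hq, -⟩ := exists_seq_of_mem_paths (A.plan_mem (A.position ρ k) ρ)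
    rw [Planner.position, ← hqm, seq_sum hq m le_rfl, hq0, ih]
    ring

/-- By `plan_visible`, a plan made on level `k * m` looks no further than level `(k + 1) * m`. -/
theorem Planner.dependsOn_position (k : ℕ) :
    DependsOn (fun ρ => A.position ρ k) (layersUpTo d (k * m)) := by
  induction k with
  | zero => intro x y _; rfl
  | succ k ih =>
    intro x y h
    have hpos : A.position x k = A.position y k :=
      ih fun w hw => h w (le_trans hw (Nat.mul_le_mul_right m (Nat.le_succ k)))
    simp only [Planner.position]
    rw [hpos, A.plan_visible (A.position y k) x y]
    intro w _ hw
    refine h w ?_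
    rw [A.position_sum] at hw
    rw [layersUpTo, Set.mem_ofPred_eq]
    linarith

theorem Planner.measurable_position (k : ℕ) : Measurable fun ρ => A.position ρ k := by
  induction k with
  | zero => exact measurable_const
  | succ k ih =>
    have h : Measurable fun x : Vertex d × (Vertex d → ℝ) => A.plan x.1 x.2 (Fin.last m) :=
      measurable_from_prod_countable_right fun v =>
        (measurable_pi_apply _).comp (A.measurable_plan v)
    exact h.comp (ih.prodMk measurable_id)

/-- The reward collected in iteration `k`. -/
noncomputable def Planner.blockReward (k : ℕ) (ρ : Vertex d → ℝ) : ℝ :=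
  maxReward ρ (A.position ρ k) m

theorem measurable_maxReward_position (k j : ℕ) :
    Measurable fun ρ => maxReward ρ (A.position ρ k) j := by
  have h : Measurable fun x : Vertex d × (Vertex d → ℝ) => maxReward x.2 x.1 j :=
    measurable_from_prod_countable_right fun v => measurable_maxReward v j
  exact h.comp ((A.measurable_position k).prodMk measurable_id)

theorem Planner.measurable_blockReward (k : ℕ) : Measurable (A.blockReward k) :=
  measurable_maxReward_position A k m

theorem Planner.dependsOn_blockReward (k : ℕ) :
    DependsOn (A.blockReward k) (layersUpTo d ((k + 1) * m)) := by
  intro x y h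
  have hpos : A.position x k = A.position y k :=
    A.dependsOn_position k fun w hw =>
      h w (le_trans hw (Nat.mul_le_mul_right m (Nat.le_succ k)))
  simp only [Planner.blockReward, hpos]
  refine maxReward_congr fun w _ hw => h w ?_
  rw [A.position_sum] at hw
  rw [layersUpTo, Set.mem_ofPred_eq]
  linarith

/-- Renewal at the planner's position. Taking `g = 1` gives the law of a block, and `g` an indicator
of an earlier block gives independence; `j` is free so that an incomplete last block is covered. -/
theorem lintegral_mul_maxReward_position (μ : Measure ℝ) [IsProbabilityMeasure μ] (k j : ℕ)
    {φ : ℝ → ℝ≥0∞} (hφ : Measurable φ) {g : (Vertex d → ℝ) → ℝ≥0∞} (hg : Measurable g)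
    (hgdep : DependsOn g (layersUpTo d (k * m))) :
    ∫⁻ ρ, g ρ * φ (maxReward ρ (A.position ρ k) j) ∂(Measure.infinitePi fun _ : Vertex d => μ) =
      (∫⁻ ρ, g ρ ∂(Measure.infinitePi fun _ : Vertex d => μ)) *
        ∫⁻ ρ, φ (maxReward ρ 0 j) ∂(Measure.infinitePi fun _ : Vertex d => μ) := by
  simp_rw [fun ρ => maxReward_eq_shift ρ (A.position ρ k) j]
  exact lintegral_mul_shift_of_dependsOn (f := fun ρ => φ (maxReward ρ 0 j)) μ
    (A.measurable_position k)
    (fun ρ => A.position_sum ρ k) (A.dependsOn_position k)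
    (hφ.comp (measurable_maxReward 0 j)) hg hgdep
    fun x y h => congrArg φ (dependsOn_maxReward_zero j h)

/-- From the position of the planner, the field looks as from the origin. -/
theorem identDistrib_maxReward_position (μ : Measure ℝ) [IsProbabilityMeasure μ] (k j : ℕ) :
    IdentDistrib (fun ρ => maxReward ρ (A.position ρ k) j) (fun ρ => maxReward ρ 0 j)
      (Measure.infinitePi fun _ : Vertex d => μ) (Measure.infinitePi fun _ : Vertex d => μ) := by
  refine ⟨(measurable_maxReward_position A k j).aemeasurable,
    (measurable_maxReward 0 j).aemeasurable, Measure.ext fun s hs => ?_⟩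
  rw [← lintegral_indicator_one hs, ← lintegral_indicator_one hs,
    lintegral_map (measurable_one.indicator hs) (measurable_maxReward_position A k j),
    lintegral_map (measurable_one.indicator hs) (measurable_maxReward 0 j)]
  simpa using lintegral_mul_maxReward_position A μ k j (measurable_one.indicator hs)
    (g := fun _ => 1) measurable_const (fun _ _ _ => rfl)

/-- Block `i` is settled by the layers up to `(i + 1) * m ≤ k * m`, where iteration `k` starts.
Pairwise independence is all the strong law asks for. -/
theorem Planner.indepFun_blockReward (μ : Measure ℝ) [IsProbabilityMeasure μ] {i k : ℕ}
    (hik : i < k) :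
    IndepFun (A.blockReward i) (A.blockReward k) (Measure.infinitePi fun _ : Vertex d => μ) := by
  rw [indepFun_iff_measure_inter_preimage_eq_mul]
  intro s t hs ht
  have hsm := A.measurable_blockReward i hs
  have htm := A.measurable_blockReward k ht
  have h := lintegral_mul_maxReward_position A μ k m (measurable_one.indicator ht)
    (g := fun ρ => s.indicator 1 (A.blockReward i ρ))
    ((measurable_one.indicator hs).comp (A.measurable_blockReward i)) ?_
  · have h1 := (identDistrib_maxReward_position A μ k m).measure_preimage_eq ht
    have h2 : (fun ρ => maxReward ρ (A.position ρ k) m) = A.blockReward k := rfl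
    rw [h2] at h1
    rw [h1, ← lintegral_indicator_one (hsm.inter htm), ← lintegral_indicator_one hsm,
      ← lintegral_indicator_one (measurable_maxReward 0 m ht)]
    refine Eq.trans (lintegral_congr fun ρ => ?_) h
    have hk : A.blockReward k ρ = maxReward ρ (A.position ρ k) m := rfl
    by_cases ha : A.blockReward i ρ ∈ s <;> by_cases hb : maxReward ρ (A.position ρ k) m ∈ t <;>
      simp [Set.indicator, ha, hb, hk]
  · intro x y hxy
    have : A.blockReward i x = A.blockReward i y := A.dependsOn_blockReward i fun w hw =>
      hxy w (le_trans hw (Nat.mul_le_mul_right m hik))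
    simp only [this]

theorem Planner.exists_seq_sum_blockReward (ρ : Vertex d → ℝ) (k : ℕ) :
    ∃ q : ℕ → Vertex d, q 0 = 0 ∧ q (k * m) = A.position ρ k ∧
      (∀ i < k * m, Edge (q i) (q (i + 1))) ∧
      ∑ i ∈ Finset.range (k * m), ρ (q (i + 1)) =
        ∑ i ∈ Finset.range k, A.blockReward i ρ := by
  induction k with
  | zero => exact ⟨fun _ => 0, rfl, rfl, by simp, by simp⟩
  | succ k ih =>
    obtain ⟨q, hq0, hqk, hq, hsum⟩ := ih
    obtain ⟨s, hs0, hsm, hs, hsp⟩ := exists_seq_of_mem_paths (A.plan_mem (A.position ρ k) ρ)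
    obtain ⟨q', hq'0, hq'm, hq', hsum'⟩ := exists_concat_seq ρ hq (hs0.trans hqk.symm) hs
    have hmax : A.blockReward k ρ = pathReward ρ (A.plan (A.position ρ k) ρ) := by
      refine IsGreatest.csSup_eq ⟨⟨_, A.plan_mem _ ρ, rfl⟩, ?_⟩
      rintro _ ⟨p, hp, rfl⟩
      exact A.plan_max _ ρ p hp
    rw [add_mul, one_mul]
    refine ⟨q', hq'0.trans hq0, hq'm.trans hsm, hq', ?_⟩
    rw [hsum', hsum, Finset.sum_range_succ, hmax, pathReward_eq_sum_seq ρ hsp]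

/-- The rewards of `k` iterations followed by an optimal path with `j` steps are at most the reward
of an optimal path over the whole distance. -/
theorem Planner.sum_blockReward_add_le (hd : 0 < d) (ρ : Vertex d → ℝ) (k j : ℕ) :
    ∑ i ∈ Finset.range k, A.blockReward i ρ + maxReward ρ (A.position ρ k) j ≤
      maxReward ρ 0 (k * m + j) := by
  obtain ⟨q, hq0, hqk, hq, hsum⟩ := A.exists_seq_sum_blockReward ρ k
  obtain ⟨p, hp, hpm⟩ := (isGreatest_maxReward hd ρ (A.position ρ k) j).1
  obtain ⟨s, hs0, -, hs, hsp⟩ := exists_seq_of_mem_paths hp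
  obtain ⟨q', hq'0, -, hq', hsum'⟩ := exists_concat_seq ρ hq (hs0.trans hqk.symm) hs
  have h := pathReward_le_of_seq (ρ := ρ) hq'
  rwa [hsum', hsum, hq'0, hq0, ← pathReward_eq_sum_seq ρ hsp, hpm] at h

end Planner

/-! ### Weights of chains of marked vertices -/

variable {d : ℕ}

/-- The total weight of the chains below `w` (with respect to the coordinatewise order), the weight
of a chain being the product of the weights `o` of its vertices. -/
noncomputable def chainWeight (o : Vertex d → ℝ≥0∞) (w : Vertex d) : ℝ≥0∞ :=
  1 + ∑ x : {x // x ∈ Finset.Iio w}, o x.1 * chainWeight o x.1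
termination_by ∑ j, w j
decreasing_by
  have hx := Finset.mem_Iio.1 x.2
  obtain ⟨hle, k, hk⟩ := Pi.lt_def.1 hx
  exact Finset.sum_lt_sum (fun j _ => hle j) ⟨k, Finset.mem_univ k, hk⟩

theorem chainWeight_eq (o : Vertex d → ℝ≥0∞) (w : Vertex d) :
    chainWeight o w = 1 + ∑ x ∈ Finset.Iio w, o x * chainWeight o x := by
  rw [chainWeight, Finset.sum_coe_sort (Finset.Iio w) fun x => o x * chainWeight o x]

/-- The number of marked vertices on a path is at most logarithmic in the total weight of chains of
marked vertices. -/
theorem two_pow_card_le_chainWeight (S : Set (Vertex d)) [DecidablePred (· ∈ S)]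
    {q : ℕ → Vertex d} {n : ℕ} (hq : ∀ i < n, Edge (q i) (q (i + 1))) :
    (2 : ℝ≥0∞) ^ ((Finset.range n).filter fun i => q (i + 1) ∈ S).card ≤
      1 + ∑ x ∈ Finset.Iic (q n), S.indicator 1 x * chainWeight (S.indicator 1) x := by
  induction n with
  | zero => simp
  | succ n ih =>
    have ih := ih fun i hi => hq i (by omega)
    have hlt := edge_lt (hq n (by omega))
    set f : Vertex d → ℝ≥0∞ := fun x => S.indicator 1 x * chainWeight (S.indicator 1) x with hf
    have hH : 1 + ∑ x ∈ Finset.Iic (q n), f x ≤ chainWeight (S.indicator 1) (q (n + 1)) := by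
      rw [chainWeight_eq]
      gcongr
      intro x hx
      exact Finset.mem_Iio.2 ((Finset.mem_Iic.1 hx).trans_lt hlt)
    have hstep : f (q (n + 1)) + ∑ x ∈ Finset.Iic (q n), f x ≤
        ∑ x ∈ Finset.Iic (q (n + 1)), f x := by
      rw [← Finset.sum_insert (by simpa using hlt.not_ge)]
      refine Finset.sum_le_sum_of_subset fun x hx => ?_
      rcases Finset.mem_insert.1 hx with rfl | hx
      · simp
      · exact Finset.mem_Iic.2 ((Finset.mem_Iic.1 hx).trans hlt.le)
    refine le_trans ?_ (add_le_add_right hstep 1)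
    rw [Finset.range_add_one, Finset.filter_insert]
    split_ifs with h
    -- A marked endpoint can be appended to every chain counted so far, or left out, so the total at
    -- least doubles.
    · rw [Finset.card_insert_of_notMem (by simp), pow_succ, mul_two]
      have h1 : f (q (n + 1)) = chainWeight (S.indicator 1) (q (n + 1)) := by simp [hf, h]
      rw [h1]
      calc _ ≤ (1 + ∑ x ∈ Finset.Iic (q n), f x) + (1 + ∑ x ∈ Finset.Iic (q n), f x) :=
            add_le_add ih ih
        _ ≤ (1 + ∑ x ∈ Finset.Iic (q n), f x) + chainWeight (S.indicator 1) (q (n + 1)) := by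
            gcongr
        _ = _ := by ring
    · exact ih.trans (by gcongr; exact le_add_self)

theorem sum_geom_le {ε : ℝ} (h0 : 0 < ε) (h1 : ε ≤ 1) (k : ℕ) :
    ∑ i ∈ Finset.Iic k, (1 + ε) ^ i ≤ 2 / ε * (1 + ε) ^ k := by
  have : Finset.Iic k = Finset.range (k + 1) := by
    ext
    simp
  rw [this, geom_sum_eq (by linarith), add_sub_cancel_left, div_mul_eq_mul_div]
  gcongr
  have := pow_pos (show 0 < 1 + ε by linarith) k
  rw [pow_succ]
  nlinarith

/-- The summand factors over the coordinates, so the sum over a box is a product of `d` geometric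
sums. -/
theorem sum_Iic_pow_le {ε : ℝ} (h0 : 0 < ε) (h1 : ε ≤ 1) (w : Vertex d) :
    ∑ x ∈ Finset.Iic w, (1 + ε) ^ (∑ j, x j) ≤ (2 / ε) ^ d * (1 + ε) ^ (∑ j, w j) := by
  have hI : Finset.Iic w = Fintype.piFinset fun j => Finset.Iic (w j) := by
    ext x
    simp [Fintype.mem_piFinset, Pi.le_def]
  simp_rw [← Finset.prod_pow_eq_pow_sum]
  rw [hI, ← Finset.prod_univ_sum fun j => Finset.Iic (w j)]
  calc ∏ j, ∑ i ∈ Finset.Iic (w j), (1 + ε) ^ i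
      ≤ ∏ j, (2 / ε * (1 + ε) ^ w j) :=
        Finset.prod_le_prod (fun j _ => Finset.sum_nonneg fun i _ => by positivity)
          fun j _ => sum_geom_le h0 h1 _
    _ = _ := by
        rw [Finset.prod_mul_distrib, Finset.prod_const, Finset.card_univ, Fintype.card_fin,
          Finset.prod_pow_eq_pow_sum]

/-- The vertices with reward above the level `s`. -/
def exceed (s : ℝ) (ρ : Vertex d → ℝ) : Set (Vertex d) := {w | s < ρ w}

theorem exceed_indicator (s : ℝ) (ρ : Vertex d → ℝ) (w : Vertex d) :
    (exceed s ρ).indicator (1 : Vertex d → ℝ≥0∞) w = (Set.Ioi s).indicator 1 (ρ w) := rfl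

theorem measurable_exceed_indicator (s : ℝ) (w : Vertex d) :
    Measurable fun ρ : Vertex d → ℝ => (exceed s ρ).indicator (1 : Vertex d → ℝ≥0∞) w := by
  simp only [exceed_indicator]
  exact (measurable_one.indicator measurableSet_Ioi).comp (measurable_pi_apply w)

theorem measurable_chainWeight (s : ℝ) (w : Vertex d) :
    Measurable fun ρ : Vertex d → ℝ => chainWeight ((exceed s ρ).indicator 1) w := by
  induction w using WellFoundedLT.induction with
  | ind w ih =>
    simp_rw [chainWeight_eq _ w]
    exact (Finset.measurable_sum _ fun x hx =>
      (measurable_exceed_indicator s x).mul (ih x (Finset.mem_Iio.1 hx))).const_add 1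

/-- The chains stay strictly below `w`, so their weight is independent of the mark at `w`; this
gives the factor `μ (Set.Ioi s)` in the recursion for expectations. -/
theorem dependsOn_chainWeight (s : ℝ) (w : Vertex d) :
    DependsOn (fun ρ : Vertex d → ℝ => chainWeight ((exceed s ρ).indicator 1) w) (Set.Iio w) := by
  induction w using WellFoundedLT.induction with
  | ind w ih =>
    intro x y h
    simp only [chainWeight_eq _ w]
    congr 1
    refine Finset.sum_congr rfl fun v hv => ?_
    have hv := Finset.mem_Iio.1 hv
    have := ih v hv fun i hi => h i (lt_trans (Set.mem_Iio.1 hi) hv)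
    simp only at this
    rw [this, exceed_indicator, exceed_indicator, h v hv]

/-! ### Expected number of large rewards on a path, and the linear moment bound -/

section Moment

variable (μ : Measure ℝ) [IsProbabilityMeasure μ]

theorem lintegral_indicator_mul_chainWeight (s : ℝ) (w : Vertex d) :
    ∫⁻ ρ, (exceed s ρ).indicator 1 w * chainWeight ((exceed s ρ).indicator 1) w
        ∂(Measure.infinitePi fun _ : Vertex d => μ) =
      μ (Set.Ioi s) * ∫⁻ ρ, chainWeight ((exceed s ρ).indicator 1) w
        ∂(Measure.infinitePi fun _ : Vertex d => μ) := by
  have h1 : ∫⁻ ρ, (exceed s ρ).indicator (1 : Vertex d → ℝ≥0∞) w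
      ∂(Measure.infinitePi fun _ : Vertex d => μ) = μ (Set.Ioi s) := by
    simp only [exceed_indicator]
    rw [← lintegral_map (μ := Measure.infinitePi fun _ : Vertex d => μ)
      (measurable_one.indicator measurableSet_Ioi) (measurable_pi_apply w),
      Measure.infinitePi_map_eval, lintegral_indicator_one measurableSet_Ioi]
  rw [lintegral_mul_of_dependsOn_disjoint μ (S := {w}) (T := Set.Iio w) (by simp)
    (measurable_exceed_indicator s w) (measurable_chainWeight s w) ?_ (dependsOn_chainWeight s w),
    h1]
  intro x y h
  simp only [exceed_indicator, h w rfl]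

variable {μ}

/-- The inductive step with a general `T`: it is used for the vertices strictly below `w` during the
induction, and for the closed box afterwards. -/
theorem lintegral_sum_chainWeight_le {s ε : ℝ} (h0 : 0 < ε) (h1 : ε ≤ 1)
    (T : Finset (Vertex d)) (w : Vertex d) (hT : T ⊆ Finset.Iic w)
    (hw : ∀ x ∈ T, ∫⁻ ρ, chainWeight ((exceed s ρ).indicator 1) x
      ∂(Measure.infinitePi fun _ : Vertex d => μ) ≤ ENNReal.ofReal (2 * (1 + ε) ^ (∑ j, x j))) :
    ∫⁻ ρ, ∑ x ∈ T, (exceed s ρ).indicator 1 x * chainWeight ((exceed s ρ).indicator 1) x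
      ∂(Measure.infinitePi fun _ : Vertex d => μ) ≤
      ENNReal.ofReal (2 * (μ.real (Set.Ioi s) * (2 / ε) ^ d) * (1 + ε) ^ (∑ j, w j)) := by
  have hmeas : ∀ x ∈ T, Measurable fun ρ : Vertex d → ℝ =>
      (exceed s ρ).indicator 1 x * chainWeight ((exceed s ρ).indicator 1) x := fun x _ =>
    (measurable_exceed_indicator s x).mul (measurable_chainWeight s x)
  rw [lintegral_finsetSum _ hmeas]
  calc _ ≤ ∑ x ∈ T, ENNReal.ofReal (μ.real (Set.Ioi s) * (2 * (1 + ε) ^ (∑ j, x j))) := by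
        refine Finset.sum_le_sum fun x hx => ?_
        rw [lintegral_indicator_mul_chainWeight, ENNReal.ofReal_mul measureReal_nonneg,
          ofReal_measureReal]
        gcongr
        exact hw x hx
    _ = ENNReal.ofReal (∑ x ∈ T, μ.real (Set.Ioi s) * (2 * (1 + ε) ^ (∑ j, x j))) :=
        (ENNReal.ofReal_sum_of_nonneg fun x _ => by positivity).symm
    _ ≤ _ := by
        refine ENNReal.ofReal_le_ofReal ?_
        have := (Finset.sum_le_sum_of_subset_of_nonneg hT fun x _ _ => by positivity).trans
          (sum_Iic_pow_le h0 h1 w)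
        calc _ = 2 * μ.real (Set.Ioi s) * ∑ x ∈ T, (1 + ε) ^ (∑ j, x j) := by
              rw [Finset.mul_sum]
              exact Finset.sum_congr rfl fun x _ => by ring
          _ ≤ 2 * μ.real (Set.Ioi s) * ((2 / ε) ^ d * (1 + ε) ^ (∑ j, w j)) := by gcongr
          _ = _ := by ring

/-- Induction along the order: `hp` makes the sum below `w` cost at most half of the bound, and the
empty chain fits into the other half. -/
theorem lintegral_chainWeight_le {s ε : ℝ} (h0 : 0 < ε) (h1 : ε ≤ 1)
    (hp : μ.real (Set.Ioi s) * (2 / ε) ^ d ≤ 1 / 2) (w : Vertex d) :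
    ∫⁻ ρ, chainWeight ((exceed s ρ).indicator 1) w
      ∂(Measure.infinitePi fun _ : Vertex d => μ) ≤
      ENNReal.ofReal (2 * (1 + ε) ^ (∑ j, w j)) := by
  induction w using WellFoundedLT.induction with
  | ind w ih =>
    simp_rw [chainWeight_eq _ w]
    rw [lintegral_add_left measurable_const]
    have h2 := lintegral_sum_chainWeight_le h0 h1 (Finset.Iio w) w
      (fun x hx => Finset.mem_Iic.2 (Finset.mem_Iio.1 hx).le)
      fun x hx => ih x (Finset.mem_Iio.1 hx)
    refine (add_le_add_right h2 _).trans ?_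
    have h3 : (1 : ℝ) ≤ (1 + ε) ^ (∑ j, w j) := one_le_pow₀ (by linarith)
    have h4 : 0 ≤ μ.real (Set.Ioi s) * (2 / ε) ^ d := by positivity
    rw [lintegral_const, measure_univ, mul_one, ← ENNReal.ofReal_one,
      ← ENNReal.ofReal_add zero_le_one (by positivity)]
    refine ENNReal.ofReal_le_ofReal ?_
    nlinarith

/-- The maximum number of vertices with reward above `s` on a path with `n` steps from the
origin. -/
noncomputable def maxCount (n : ℕ) (s : ℝ) (ρ : Vertex d → ℝ) : ℝ≥0∞ :=
  ⨆ p ∈ paths (0 : Vertex d) n, ∑ i : Fin n, (exceed s ρ).indicator 1 (p i.succ)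

/-- All paths end inside the box of side `n`, so one random sum controls their counts
simultaneously. -/
theorem maxCount_le_of_forall_card {n : ℕ} {s : ℝ} {ρ : Vertex d → ℝ} {B : ℝ≥0∞}
    (h : ∀ c : ℕ, c ≤ n → (2 : ℝ≥0∞) ^ c ≤ 1 + ∑ x ∈ Finset.Iic (fun _ : Fin d => n),
      (exceed s ρ).indicator 1 x * chainWeight ((exceed s ρ).indicator 1) x → (c : ℝ≥0∞) ≤ B) :
    maxCount n s ρ ≤ B := by
  classical
  refine iSup₂_le fun p hp => ?_
  obtain ⟨q, hq0, -, hq, hqp⟩ := exists_seq_of_mem_paths hp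
  have hsum : ∑ i : Fin n, (exceed s ρ).indicator (1 : Vertex d → ℝ≥0∞) (p i.succ) =
      (((Finset.range n).filter fun i => q (i + 1) ∈ exceed s ρ).card : ℝ≥0∞) := by
    rw [Finset.card_filter, Finset.sum_range, Nat.cast_sum]
    refine Finset.sum_congr rfl fun i _ => ?_
    have := hqp i.succ
    rw [Fin.val_succ] at this
    rw [this]
    simp [Set.indicator]
  rw [hsum]
  refine h _ ((Finset.card_filter_le _ _).trans (Finset.card_range n).le)
    ((two_pow_card_le_chainWeight _ hq).trans (add_le_add_right
      (Finset.sum_le_sum_of_subset (Finset.Iic_subset_Iic.2 fun j => ?_)) 1))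
  have h1 := seq_sum hq n le_rfl
  have h2 : q n j ≤ ∑ j, q n j :=
    Finset.single_le_sum (f := q n) (fun _ _ => Nat.zero_le _) (Finset.mem_univ j)
  rw [hq0] at h1
  simpa [h1] using h2

theorem lintegral_sum_Iic_chainWeight_le {n : ℕ} {s ε : ℝ} (h0 : 0 < ε) (h1 : ε ≤ 1)
    (hp : μ.real (Set.Ioi s) * (2 / ε) ^ d ≤ 1 / 2) :
    ∫⁻ ρ, ∑ x ∈ Finset.Iic (fun _ : Fin d => n),
      (exceed s ρ).indicator 1 x * chainWeight ((exceed s ρ).indicator 1) x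
      ∂(Measure.infinitePi fun _ : Vertex d => μ) ≤
      ENNReal.ofReal (2 * (μ.real (Set.Ioi s) * (2 / ε) ^ d) * Real.exp (ε * (d * n))) := by
  refine (lintegral_sum_chainWeight_le h0 h1 _ _ subset_rfl
    fun x _ => lintegral_chainWeight_le h0 h1 hp x).trans ?_
  refine ENNReal.ofReal_le_ofReal ?_
  gcongr
  calc (1 + ε) ^ (∑ j : Fin d, n) ≤ Real.exp ε ^ (∑ j : Fin d, n) := by
        gcongr
        rw [add_comm]
        exact Real.add_one_le_exp ε
    _ = _ := by rw [← Real.exp_nat_mul]; simp [mul_comm]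

/-- For small densities the expected count is at most the expected number of points. -/
theorem lintegral_maxCount_le_of_small (hd : 0 < d) {n : ℕ} (hn : 0 < n) {s x : ℝ} (hx : 0 ≤ x)
    (hx4 : x ≤ 1 / 4) (hxd : μ.real (Set.Ioi s) * n ^ d = x ^ d) :
    ∫⁻ ρ, maxCount n s ρ ∂(Measure.infinitePi fun _ : Vertex d => μ) ≤
      ENNReal.ofReal (4 * Real.exp d * x) := by
  have hn' : (0 : ℝ) < n := by exact_mod_cast hn
  have h2x : (2 * x) ^ d ≤ 2 * x := pow_le_of_le_one (by linarith) (by linarith) hd.ne'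
  -- The choice `ε = 1 / n` keeps the exponential factor at `exp d`.
  have hp : μ.real (Set.Ioi s) * (2 / (1 / (n : ℝ))) ^ d = (2 * x) ^ d := by
    rw [mul_pow, ← hxd, div_div_eq_mul_div, div_one, mul_pow]
    ring
  have hε : (1 : ℝ) / n ≤ 1 := (div_le_one hn').2 (by exact_mod_cast hn)
  refine (lintegral_mono fun ρ => maxCount_le_of_forall_card fun c _ hc => ?_).trans
    ((lintegral_sum_Iic_chainWeight_le (n := n) (s := s) (by positivity) hε
      (by rw [hp]; linarith)).trans (ENNReal.ofReal_le_ofReal ?_))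
  -- This cancels the empty chain, so no additive constant survives and the bound vanishes with `x`.
  · have h1 : (1 : ℝ≥0∞) + c ≤ 2 ^ c := by
      have : c + 1 ≤ 2 ^ c := Nat.lt_two_pow_self
      rw [add_comm]
      exact_mod_cast this
    exact (ENNReal.add_le_add_iff_left ENNReal.one_ne_top).1 (h1.trans hc)
  · rw [hp]
    have h3 : (1 : ℝ) / n * (d * n) = d := by field_simp
    rw [h3]
    have := Real.exp_pos (d : ℝ)
    nlinarith

/-- The expected chain sum is at most `exp K`, and `c ≤ 2 * K + 2 * exp (-K) * 2 ^ c` (from `t + 1 ≤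
exp t` at `t = c * log 2 - K`) turns this into a count of order `K`. The leftover constant 4 is at
most `16 * x`. -/
theorem lintegral_maxCount_le_of_large {n : ℕ} {s x ε : ℝ} (h0 : 0 < ε) (h1 : ε ≤ 1)
    (hp : μ.real (Set.Ioi s) * (2 / ε) ^ d ≤ 1 / 2) (hx4 : 1 / 4 ≤ x) (hx : ε * n = 4 * x) :
    ∫⁻ ρ, maxCount n s ρ ∂(Measure.infinitePi fun _ : Vertex d => μ) ≤
      ENNReal.ofReal ((8 * d + 16) * x) := by
  set K : ℝ := ε * (d * n) with hK
  have hK0 : 0 ≤ K := by positivity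
  have hKx : K = 4 * d * x := by rw [hK, mul_left_comm, hx]; ring
  have hpt : ∀ ρ : Vertex d → ℝ, maxCount n s ρ ≤ ENNReal.ofReal (2 * K) +
      ENNReal.ofReal (2 * Real.exp (-K)) * (1 + ∑ x ∈ Finset.Iic (fun _ : Fin d => n),
      (exceed s ρ).indicator 1 x * chainWeight ((exceed s ρ).indicator 1) x) := by
    intro ρ
    refine maxCount_le_of_forall_card fun c _ hc => ?_
    refine le_trans ?_ (add_le_add_right (mul_le_mul_right hc _) _)
    have h2 : (2 : ℝ≥0∞) ^ c = ENNReal.ofReal (2 ^ c) := by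
      rw [ENNReal.ofReal_pow zero_le_two]; simp
    rw [h2, ← ENNReal.ofReal_mul (by positivity), ← ENNReal.ofReal_add (by positivity)
      (by positivity), ← ENNReal.ofReal_natCast]
    refine ENNReal.ofReal_le_ofReal ?_
    have h3 : Real.exp (-K) * 2 ^ c = Real.exp (c * Real.log 2 - K) := by
      rw [Real.exp_sub, mul_comm (c : ℝ), Real.exp_mul, Real.exp_log two_pos, Real.exp_neg,
        Real.rpow_natCast]
      ring
    have h4 := Real.add_one_le_exp (c * Real.log 2 - K)
    have h5 : (1 / 2 : ℝ) ≤ Real.log 2 := by linarith [Real.log_two_gt_d9]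
    have h6 : (0 : ℝ) ≤ c := Nat.cast_nonneg c
    rw [mul_assoc, h3]
    nlinarith
  refine (lintegral_mono hpt).trans ?_
  have hmeas : Measurable fun ρ : Vertex d → ℝ => ∑ x ∈ Finset.Iic (fun _ : Fin d => n),
      (exceed s ρ).indicator 1 x * chainWeight ((exceed s ρ).indicator 1) x :=
    Finset.measurable_sum _ fun x _ =>
      (measurable_exceed_indicator s x).mul (measurable_chainWeight s x)
  rw [lintegral_add_left measurable_const, lintegral_const_mul _ (hmeas.const_add 1),
    lintegral_add_left measurable_const, lintegral_const, lintegral_const, measure_univ, mul_one,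
    mul_one]
  have hexp : (1 : ℝ) ≤ Real.exp K := Real.one_le_exp hK0
  calc _ ≤ ENNReal.ofReal (2 * K) + ENNReal.ofReal (2 * Real.exp (-K)) *
        (ENNReal.ofReal 1 + ENNReal.ofReal (Real.exp K)) := by
        rw [ENNReal.ofReal_one]
        gcongr
        refine (lintegral_sum_Iic_chainWeight_le h0 h1 hp).trans (ENNReal.ofReal_le_ofReal ?_)
        rw [← hK]
        nlinarith
    _ = ENNReal.ofReal (2 * K + 2 * Real.exp (-K) * (1 + Real.exp K)) := by
        rw [← ENNReal.ofReal_add zero_le_one (by positivity), ← ENNReal.ofReal_mul (by positivity),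
          ← ENNReal.ofReal_add (by positivity) (by positivity)]
    _ ≤ _ := by
        refine ENNReal.ofReal_le_ofReal ?_
        have h2 : Real.exp (-K) * Real.exp K = 1 := by rw [← Real.exp_add]; simp
        have h3 : Real.exp (-K) ≤ 1 := Real.exp_le_one_iff.2 (by linarith)
        nlinarith

/-- The scale is `x = n * y` with `y = p ^ (1 / d)`. For large `x`, `ε = 4 * y` gives `p * (2 / ε) ^
d = (1 / 2) ^ d`; this needs `4 * y ≤ 1`, and otherwise the trivial bound `n` suffices. -/
theorem lintegral_maxCount_le (hd : 0 < d) (n : ℕ) (s : ℝ) :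
    ∫⁻ ρ, maxCount n s ρ ∂(Measure.infinitePi fun _ : Vertex d => μ) ≤
      ENNReal.ofReal ((4 * Real.exp d + 8 * d + 16) * n *
        μ.real (Set.Ioi s) ^ (1 / (d : ℝ))) := by
  rcases Nat.eq_zero_or_pos n with rfl | hn
  · have : ∀ ρ : Vertex d → ℝ, maxCount 0 s ρ = 0 := fun ρ => by simp [maxCount]
    simp [this]
  set p := μ.real (Set.Ioi s)
  have hp0 : 0 ≤ p := measureReal_nonneg
  set y := p ^ (1 / (d : ℝ)) with hy
  have hy0 : 0 ≤ y := Real.rpow_nonneg hp0 _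
  have hyd : y ^ d = p := by
    rw [hy, one_div, Real.rpow_inv_natCast_pow hp0 hd.ne']
  have hn' : (0 : ℝ) < n := by exact_mod_cast hn
  have hexp := Real.exp_pos (d : ℝ)
  have hx0 : 0 ≤ n * y := by positivity
  have hd0 : (0 : ℝ) ≤ d * (n * y) := by positivity
  have he0 : 0 ≤ Real.exp d * (n * y) := by positivity
  rw [mul_assoc]
  rcases le_total (n * y) (1 / 4) with hx | hx
  · refine (lintegral_maxCount_le_of_small hd hn hx0 hx
      (by rw [mul_pow, hyd, mul_comm])).trans (ENNReal.ofReal_le_ofReal ?_)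
    nlinarith
  rcases le_total (4 * y) 1 with h4 | h4
  · have hypos : 0 < y := by
      by_contra h
      have : y = 0 := le_antisymm (not_lt.1 h) hy0
      rw [this] at hx
      norm_num at hx
    refine (lintegral_maxCount_le_of_large (ε := 4 * y) (by positivity) h4 ?_ hx (by ring)).trans
      (ENNReal.ofReal_le_ofReal ?_)
    · change p * _ ≤ _
      rw [← hyd, ← mul_pow]
      have : y * (2 / (4 * y)) = 1 / 2 := by field_simp; norm_num
      rw [this]
      exact pow_le_of_le_one (by norm_num) (by norm_num) hd.ne'
    · nlinarith
  · have : ∀ ρ : Vertex d → ℝ, maxCount n s ρ ≤ n := fun ρ =>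
      maxCount_le_of_forall_card fun c hc _ => by exact_mod_cast hc
    refine (lintegral_mono this).trans ?_
    rw [lintegral_const, measure_univ, mul_one, ← ENNReal.ofReal_natCast]
    refine ENNReal.ofReal_le_ofReal ?_
    nlinarith

/-- The maximum reward is at most the integral of the maximum counts over the positive levels. -/
theorem ofReal_maxReward_le_lintegral_maxCount (hd : 0 < d) (n : ℕ) (ρ : Vertex d → ℝ) :
    ENNReal.ofReal (maxReward ρ 0 n) ≤ ∫⁻ s in Set.Ioi 0, maxCount n s ρ := by
  obtain ⟨p, hp, hpm⟩ := (isGreatest_maxReward hd ρ 0 n).1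
  have hs : ∀ x : ℝ, ∫⁻ s in Set.Ioi 0, (Set.Ioi s).indicator (1 : ℝ → ℝ≥0∞) x =
      ENNReal.ofReal x := by
    intro x
    have : ∀ s, (Set.Ioi s).indicator (1 : ℝ → ℝ≥0∞) x = (Set.Iio x).indicator 1 s := fun s => by
      simp [Set.indicator]
    simp_rw [this]
    rw [lintegral_indicator_one measurableSet_Iio, Measure.restrict_apply measurableSet_Iio,
      Set.inter_comm, Set.Ioi_inter_Iio, Real.volume_Ioo, sub_zero]
  have hm : ∀ x : ℝ, Measurable fun s : ℝ => (Set.Ioi s).indicator (1 : ℝ → ℝ≥0∞) x := by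
    intro x
    have : (fun s : ℝ => (Set.Ioi s).indicator (1 : ℝ → ℝ≥0∞) x) = (Set.Iio x).indicator 1 := by
      funext s
      simp [Set.indicator]
    rw [this]
    exact measurable_one.indicator measurableSet_Iio
  calc ENNReal.ofReal (maxReward ρ 0 n)
      ≤ ∑ i : Fin n, ENNReal.ofReal (ρ (p i.succ)) := by
        rw [← hpm, pathReward]
        exact Finset.le_sum_of_subadditive _ ENNReal.ofReal_zero.le
          (fun _ _ => ENNReal.ofReal_add_le) _ _
    _ = ∫⁻ s in Set.Ioi 0, ∑ i : Fin n, (Set.Ioi s).indicator 1 (ρ (p i.succ)) := by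
        rw [lintegral_finsetSum _ fun i _ => hm _]
        simp_rw [hs]
    -- The optimal path competes at every level, where `maxCount` may pick a different path for each
    -- `s`.
    _ ≤ _ := lintegral_mono fun s => le_iSup₂_of_le p hp le_rfl

theorem measurable_maxCount (n : ℕ) :
    Measurable fun x : (Vertex d → ℝ) × ℝ => maxCount n x.2 x.1 := by
  refine Measurable.biSup _ (Set.to_countable _) fun p _ =>
    Finset.measurable_sum _ fun i _ => ?_
  have : (fun x : (Vertex d → ℝ) × ℝ =>
      (exceed x.2 x.1).indicator (1 : Vertex d → ℝ≥0∞) (p i.succ)) =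
      {x : (Vertex d → ℝ) × ℝ | x.2 < x.1 (p i.succ)}.indicator 1 := rfl
  rw [this]
  exact measurable_one.indicator (measurableSet_lt measurable_snd (by fun_prop))

/-- The expected maximum reward grows at most linearly. -/
theorem lintegral_ofReal_maxReward_le (hd : 0 < d)
    (htail : IntegrableOn (fun s : ℝ => (1 - cdf μ s) ^ (1 / (d : ℝ))) (Set.Ioi 0)) (n : ℕ) :
    ∫⁻ ρ, ENNReal.ofReal (maxReward ρ 0 n) ∂(Measure.infinitePi fun _ : Vertex d => μ) ≤
      ENNReal.ofReal (((4 * Real.exp d + 8 * d + 16) *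
        ∫ s in Set.Ioi 0, (1 - cdf μ s) ^ (1 / (d : ℝ))) * n) := by
  have hcdf : ∀ s, μ.real (Set.Ioi s) = 1 - cdf μ s := by
    intro s
    rw [cdf_eq_real, ← Set.compl_Iic, probReal_compl_eq_one_sub measurableSet_Iic]
  have hnn : ∀ s, 0 ≤ (1 - cdf μ s) ^ (1 / (d : ℝ)) := fun s => by
    rw [← hcdf]; positivity
  calc _ ≤ ∫⁻ ρ, (∫⁻ s in Set.Ioi (0 : ℝ), maxCount n s ρ) ∂(Measure.infinitePi fun _ : Vertex d => μ) :=
        lintegral_mono fun ρ => ofReal_maxReward_le_lintegral_maxCount hd n ρ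
    _ = ∫⁻ s in Set.Ioi 0, ∫⁻ ρ, maxCount n s ρ ∂(Measure.infinitePi fun _ : Vertex d => μ) :=
        lintegral_lintegral_swap (measurable_maxCount n).aemeasurable
    _ ≤ ∫⁻ s in Set.Ioi 0, ENNReal.ofReal ((4 * Real.exp d + 8 * d + 16) * n *
        (1 - cdf μ s) ^ (1 / (d : ℝ))) := lintegral_mono fun s => by
          rw [← hcdf]
          exact lintegral_maxCount_le hd n s
    _ = ENNReal.ofReal (∫ s in Set.Ioi 0, (4 * Real.exp d + 8 * d + 16) * n *
        (1 - cdf μ s) ^ (1 / (d : ℝ))) :=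
        (ofReal_integral_eq_lintegral_ofReal (htail.const_mul _)
          (ae_of_all _ fun s => mul_nonneg (by positivity) (hnn s))).symm
    _ = _ := by
        rw [integral_const_mul, mul_right_comm]

end Moment

/-! ### The limit of the means and convergence in L¹ -/

section Limit

variable {μ : Measure ℝ} [IsProbabilityMeasure μ]

/-- The linear bound controls the positive part; the negative part is compared with one fixed path.
-/
theorem integrable_maxReward_zero (hd : 0 < d) (hneg : Integrable (fun x : ℝ => max (-x) 0) μ)
    (htail : IntegrableOn (fun s : ℝ => (1 - cdf μ s) ^ (1 / (d : ℝ))) (Set.Ioi 0)) (n : ℕ) :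
    Integrable (fun ρ => maxReward ρ 0 n) (Measure.infinitePi fun _ : Vertex d => μ) := by
  refine ⟨(measurable_maxReward 0 n).aestronglyMeasurable, ?_⟩
  obtain ⟨p, hp⟩ := paths_nonempty hd (0 : Vertex d) n
  have hpt : ∀ ρ : Vertex d → ℝ, ‖maxReward ρ 0 n‖ₑ ≤
      ENNReal.ofReal (maxReward ρ 0 n) + ∑ i : Fin n, ENNReal.ofReal (-ρ (p i.succ)) := by
    intro ρ
    have h1 : pathReward ρ p ≤ maxReward ρ 0 n := (isGreatest_maxReward hd ρ 0 n).2 ⟨p, hp, rfl⟩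
    rw [← ofReal_norm, Real.norm_eq_abs]
    rcases le_total 0 (maxReward ρ 0 n) with h | h
    · rw [abs_of_nonneg h]
      exact le_self_add
    · rw [abs_of_nonpos h]
      refine le_trans ?_ le_add_self
      calc ENNReal.ofReal (-maxReward ρ 0 n) ≤ ENNReal.ofReal (∑ i : Fin n, -ρ (p i.succ)) := by
            refine ENNReal.ofReal_le_ofReal ?_
            rw [Finset.sum_neg_distrib]
            exact neg_le_neg h1
        _ ≤ _ := Finset.le_sum_of_subadditive _ ENNReal.ofReal_zero.le
          (fun _ _ => ENNReal.ofReal_add_le) _ _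
  have hone : ∀ w : Vertex d,
      ∫⁻ ρ, ENNReal.ofReal (-ρ w) ∂(Measure.infinitePi fun _ : Vertex d => μ) < ∞ := by
    intro w
    rw [← lintegral_map (μ := Measure.infinitePi fun _ : Vertex d => μ)
      (f := fun x : ℝ => ENNReal.ofReal (-x)) (by fun_prop) (measurable_pi_apply w),
      Measure.infinitePi_map_eval]
    refine lt_of_le_of_lt (lintegral_mono fun x => ?_) hneg.lintegral_lt_top
    exact ENNReal.ofReal_le_ofReal (le_max_left _ _)
  refine lt_of_le_of_lt (lintegral_mono hpt) ?_
  rw [lintegral_add_left (measurable_maxReward 0 n).ennreal_ofReal,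
    lintegral_finsetSum _ fun i _ => by fun_prop]
  exact ENNReal.add_lt_top.2
    ⟨(lintegral_ofReal_maxReward_le hd htail n).trans_lt ENNReal.ofReal_lt_top,
      ENNReal.sum_lt_top.2 fun i _ => hone _⟩

/-- One iteration with range `n`, continued by an optimal path with `m` steps, competes for `n + m`
steps, and the continuation has the law of the maximum from the origin. -/
theorem integral_maxReward_superadditive (hd : 0 < d)
    (hint : ∀ n, Integrable (fun ρ => maxReward ρ 0 n) (Measure.infinitePi fun _ : Vertex d => μ))
    (n m : ℕ) :
    ∫ ρ, maxReward ρ 0 n ∂(Measure.infinitePi fun _ : Vertex d => μ) +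
        ∫ ρ, maxReward ρ 0 m ∂(Measure.infinitePi fun _ : Vertex d => μ) ≤
      ∫ ρ, maxReward ρ 0 (n + m) ∂(Measure.infinitePi fun _ : Vertex d => μ) := by
  obtain ⟨A⟩ := planner_nonempty hd n
  have hid := identDistrib_maxReward_position A μ 1 m
  have hint1 := hid.integrable_iff.2 (hint m)
  rw [← hid.integral_eq, ← integral_add (hint n) hint1]
  refine integral_mono ((hint n).add hint1) (hint _) fun ρ => ?_
  have h := A.sum_blockReward_add_le hd ρ 1 m
  rwa [Finset.sum_range_one, one_mul] at h

theorem exists_tendsto_integral_maxReward (hd : 0 < d)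
    (hneg : Integrable (fun x : ℝ => max (-x) 0) μ)
    (htail : IntegrableOn (fun s : ℝ => (1 - cdf μ s) ^ (1 / (d : ℝ))) (Set.Ioi 0)) :
    ∃ R : ℝ, Tendsto (fun n : ℕ =>
      (∫ ρ, maxReward ρ 0 n ∂(Measure.infinitePi fun _ : Vertex d => μ)) / n) atTop (𝓝 R) := by
  have hint := integrable_maxReward_zero hd hneg htail
  have hsub : Subadditive fun n : ℕ =>
      -∫ ρ, maxReward ρ 0 n ∂(Measure.infinitePi fun _ : Vertex d => μ) := fun n m => by
    have := integral_maxReward_superadditive hd hint n m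
    linarith
  set C : ℝ := (4 * Real.exp d + 8 * d + 16) *
    ∫ s in Set.Ioi 0, (1 - cdf μ s) ^ (1 / (d : ℝ)) with hC
  have hC0 : 0 ≤ C := by
    refine mul_nonneg (by positivity) (integral_nonneg fun s => ?_)
    exact Real.rpow_nonneg (sub_nonneg.2 (cdf_le_one μ s)) _
  have hle : ∀ n : ℕ,
      ∫ ρ, maxReward ρ 0 n ∂(Measure.infinitePi fun _ : Vertex d => μ) ≤ C * n := by
    intro n
    rw [integral_eq_lintegral_pos_part_sub_lintegral_neg_part (hint n)]
    refine (sub_le_self _ ENNReal.toReal_nonneg).trans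
      (ENNReal.toReal_le_of_le_ofReal (by positivity) (lintegral_ofReal_maxReward_le hd htail n))
  have hlim := hsub.tendsto_lim ⟨-C, by
    rintro _ ⟨n, rfl⟩
    rcases Nat.eq_zero_or_pos n with rfl | hn
    · simpa using hC0
    · have hn' : (0 : ℝ) < n := by exact_mod_cast hn
      rw [le_div_iff₀ hn']
      linarith [hle n]⟩
  refine ⟨-hsub.lim, ?_⟩
  have := hlim.neg
  simpa [neg_div] using this

/-- Comparison of a maximum reward with the rewards of a planner that always plans `k` steps
ahead. -/
theorem abs_maxReward_div_sub_le (hd : 0 < d) {k m : ℕ} (hk : 0 < k) (hm : 0 < m)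
    (A : Planner d k) (R E : ℝ) (ρ : Vertex d → ℝ) :
    |maxReward ρ 0 m / m - R| ≤ (maxReward ρ 0 m / m - R) +
      2 * (|((m / k : ℕ) : ℝ)⁻¹ • (∑ i ∈ Finset.range (m / k), A.blockReward i ρ) - E| +
        (|E| + |maxReward ρ (A.position ρ (m / k)) (m % k)|) / m + |E / k - R|) := by
  have hm' : (0 : ℝ) < m := by exact_mod_cast hm
  have hk' : (1 : ℝ) ≤ k := by exact_mod_cast hk
  set N := m / k with hN
  set j := m % k with hj
  set S := ∑ i ∈ Finset.range N, A.blockReward i ρ with hS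
  set D := maxReward ρ (A.position ρ N) j with hD
  have hmNj : m = N * k + j := by rw [hN, hj, mul_comm, Nat.div_add_mod]
  have hmNj' : (m : ℝ) = N * k + j := by exact_mod_cast hmNj
  have hle : S + D ≤ maxReward ρ 0 m := by
    conv_rhs => rw [hmNj]
    exact A.sum_blockReward_add_le hd ρ N j
  have hjk : (j : ℝ) ≤ k := by exact_mod_cast (Nat.mod_lt m hk).le
  have hN0 : (0 : ℝ) ≤ N := Nat.cast_nonneg N
  have hj0 : (0 : ℝ) ≤ j := Nat.cast_nonneg j
  set b := |(N : ℝ)⁻¹ • S - E| with hb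
  have hSN : |S - N * E| ≤ m * b := by
    -- For `m < k` there is no complete block: the sum is empty and the inverse of zero is zero.
    rcases Nat.eq_zero_or_pos N with h0 | h0
    · have : S = 0 := by rw [hS, h0]; simp
      rw [this, h0]
      simp only [Nat.cast_zero, zero_mul, sub_zero, abs_zero]
      positivity
    · have hN' : (0 : ℝ) < N := by exact_mod_cast h0
      have h1 : S - N * E = N * ((N : ℝ)⁻¹ • S - E) := by
        rw [smul_eq_mul]; field_simp
      rw [h1, abs_mul, abs_of_pos hN']
      refine mul_le_mul_of_nonneg_right ?_ (abs_nonneg _)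
      rw [hmNj']
      nlinarith
  have hY : |(S + D) / m - R| ≤ b + (|E| + |D|) / m + |E / k - R| := by
    have h1 : (S + D) / m - R = (S - N * E) / m + (D - E * (j / k)) / m + (E / k - R) := by
      have : (S - N * E) / m + (D - E * (j / k)) / m = (S + D) / m - E / k := by
        rw [hmNj'] at hm' ⊢
        field_simp
        ring
      rw [this]; ring
    rw [h1]
    refine (abs_add_le _ _).trans (add_le_add_left ((abs_add_le _ _).trans ?_) _)
    rw [abs_div, abs_div, abs_of_pos hm']
    refine add_le_add ?_ ?_
    · rw [div_le_iff₀ hm']; linarith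
    · gcongr
      have h2 : |E * (j / k)| ≤ |E| := by
        rw [abs_mul, abs_of_nonneg (a := (j : ℝ) / k) (by positivity)]
        exact mul_le_of_le_one_right (abs_nonneg _) ((div_le_one (by linarith)).2 hjk)
      exact (abs_sub _ _).trans (by linarith)
  have hle' : (S + D) / m ≤ maxReward ρ 0 m / m := by gcongr
  -- What remains is `|x| ≤ x + 2 * |y|` for `y ≤ x`; only the lower bound by the planner is
  -- pointwise, the upper side is left to the expectation of `x`.
  have h1 := neg_abs_le ((S + D) / m - R)
  have h2 := abs_nonneg ((S + D) / m - R)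
  rcases abs_cases (maxReward ρ 0 m / m - R) with ⟨h, _⟩ | ⟨h, _⟩ <;> rw [h] <;> linarith

theorem Planner.tendsto_integral_abs_mean_blockReward {k : ℕ} (A : Planner d k)
    (hint : Integrable (fun ρ => maxReward ρ 0 k) (Measure.infinitePi fun _ : Vertex d => μ)) :
    Tendsto (fun N : ℕ => ∫ ρ, |(N : ℝ)⁻¹ • (∑ i ∈ Finset.range N, A.blockReward i ρ) -
        ∫ ρ, maxReward ρ 0 k ∂(Measure.infinitePi fun _ : Vertex d => μ)|
        ∂(Measure.infinitePi fun _ : Vertex d => μ)) atTop (𝓝 0) := by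
  have hid : ∀ i, IdentDistrib (A.blockReward i) (A.blockReward 0)
      (Measure.infinitePi fun _ : Vertex d => μ) (Measure.infinitePi fun _ : Vertex d => μ) :=
    fun i => identDistrib_maxReward_position A μ i k
  have h := strong_law_Lp (p := 1) le_rfl ENNReal.one_ne_top A.blockReward
    (memLp_one_iff_integrable.2 hint) (fun i j hij => ?_) hid
  · have h2 := (ENNReal.tendsto_toReal ENNReal.zero_ne_top).comp h
    refine Tendsto.congr (fun N => ?_) h2
    have hS : Measurable fun ρ => (N : ℝ)⁻¹ • (∑ i ∈ Finset.range N, A.blockReward i ρ) := by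
      simp only [smul_eq_mul]
      exact Measurable.const_mul (Finset.measurable_sum _ fun i _ => A.measurable_blockReward i) _
    have hm : AEStronglyMeasurable (fun ρ => (N : ℝ)⁻¹ • (∑ i ∈ Finset.range N, A.blockReward i ρ) -
        ∫ ρ, maxReward ρ 0 k ∂(Measure.infinitePi fun _ : Vertex d => μ))
        (Measure.infinitePi fun _ : Vertex d => μ) :=
      (hS.sub_const _).aestronglyMeasurable
    simp only [Function.comp, eLpNorm_one_eq_lintegral_enorm]
    exact (integral_norm_eq_lintegral_enorm hm).symm
  · rcases lt_or_gt_of_ne hij with h | h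
    · exact A.indepFun_blockReward μ h
    · exact (A.indepFun_blockReward μ h).symm

/-- The mean maximum reward converges in `L¹`. -/
theorem tendsto_integral_abs_maxReward_div_sub (hd : 0 < d)
    (hint : ∀ n, Integrable (fun ρ => maxReward ρ 0 n) (Measure.infinitePi fun _ : Vertex d => μ))
    {R : ℝ} (hR : Tendsto (fun n : ℕ =>
      (∫ ρ, maxReward ρ 0 n ∂(Measure.infinitePi fun _ : Vertex d => μ)) / n) atTop (𝓝 R)) :
    Tendsto (fun m : ℕ => ∫ ρ, |maxReward ρ 0 m / m - R|
      ∂(Measure.infinitePi fun _ : Vertex d => μ)) atTop (𝓝 0) := by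
  set Q := Measure.infinitePi fun _ : Vertex d => μ with hQ
  have hnn : ∀ m : ℕ, 0 ≤ ∫ ρ, |maxReward ρ 0 m / m - R| ∂Q :=
    fun m => integral_nonneg fun _ => abs_nonneg _
  rw [Metric.tendsto_atTop]
  intro δ hδ
  obtain ⟨k, hk, hkR⟩ : ∃ k : ℕ, 0 < k ∧ |(∫ ρ, maxReward ρ 0 k ∂Q) / k - R| < δ / 4 := by
    have h := (Metric.tendsto_nhds.1 hR (δ / 4) (by positivity)).and (eventually_gt_atTop 0)
    obtain ⟨k, hk1, hk2⟩ := h.exists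
    exact ⟨k, hk2, by simpa [Real.dist_eq] using hk1⟩
  obtain ⟨A⟩ := planner_nonempty hd k
  set E := ∫ ρ, maxReward ρ 0 k ∂Q with hE
  set b : ℕ → ℝ := fun N => ∫ ρ, |(N : ℝ)⁻¹ • (∑ i ∈ Finset.range N, A.blockReward i ρ) - E| ∂Q
    with hb
  -- A bound for the incomplete block of `m % k < k` steps, uniform in `m`.
  set C : ℝ := ∑ j ∈ Finset.range k, ∫ ρ, |maxReward ρ 0 j| ∂Q with hC
  have hblk : ∀ i, Integrable (A.blockReward i) Q := fun i =>
    (identDistrib_maxReward_position A μ i k).integrable_iff.2 (hint k)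
  have hbound : ∀ m : ℕ, 0 < m → ∫ ρ, |maxReward ρ 0 m / m - R| ∂Q ≤
      ((∫ ρ, maxReward ρ 0 m ∂Q) / m - R) +
        2 * (b (m / k) + (|E| + C) / m + |E / k - R|) := by
    intro m hm
    have hidD := identDistrib_maxReward_position A μ (m / k) (m % k)
    have hintD := (hidD.integrable_iff.2 (hint (m % k))).abs
    have hX : Integrable (fun ρ : Vertex d → ℝ => maxReward ρ 0 m / m - R) Q :=
      ((hint m).div_const _).sub (integrable_const R)
    have hS : Integrable (fun ρ : Vertex d → ℝ =>
        ((m / k : ℕ) : ℝ)⁻¹ • (∑ i ∈ Finset.range (m / k), A.blockReward i ρ)) Q := by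
      simp only [smul_eq_mul]
      exact Integrable.const_mul (integrable_finsetSum _ fun i _ => hblk i) _
    have hB : Integrable (fun ρ : Vertex d → ℝ =>
        |((m / k : ℕ) : ℝ)⁻¹ • (∑ i ∈ Finset.range (m / k), A.blockReward i ρ) - E|) Q :=
      (hS.sub (integrable_const E)).abs
    have hDi : Integrable (fun ρ : Vertex d → ℝ =>
        (|E| + |maxReward ρ (A.position ρ (m / k)) (m % k)|) / m) Q :=
      ((integrable_const _).add hintD).div_const _
    have hDC : ∫ ρ, |maxReward ρ (A.position ρ (m / k)) (m % k)| ∂Q ≤ C := by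
      have h1 := (hidD.comp (u := fun x : ℝ => |x|) (by fun_prop)).integral_eq
      simp only [Function.comp] at h1
      rw [h1]
      exact Finset.single_le_sum (f := fun j => ∫ ρ, |maxReward ρ 0 j| ∂Q)
        (fun j _ => integral_nonneg fun _ => abs_nonneg _) (Finset.mem_range.2 (Nat.mod_lt m hk))
    refine (integral_mono hX.abs (hX.add (((hB.add hDi).add (integrable_const _)).const_mul 2))
      fun ρ => abs_maxReward_div_sub_le hd hk hm A R E ρ).trans ?_
    rw [integral_add' hX (((hB.add hDi).add (integrable_const _)).const_mul 2),
      integral_sub ((hint m).div_const _) (integrable_const R), integral_div, integral_const_mul,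
      integral_add' (hB.add hDi) (integrable_const _), integral_add' hB hDi, integral_div,
      integral_add (integrable_const _) hintD]
    simp only [integral_const, probReal_univ, one_smul]
    gcongr
  have hlim : Tendsto (fun m : ℕ => ((∫ ρ, maxReward ρ 0 m ∂Q) / m - R) +
      2 * (b (m / k) + (|E| + C) / m + |E / k - R|)) atTop
      (𝓝 ((R - R) + 2 * (0 + 0 + |E / k - R|))) := by
    refine (hR.sub_const R).add (Tendsto.const_mul 2 (Tendsto.add_const _ (Tendsto.add ?_ ?_)))
    · exact (A.tendsto_integral_abs_mean_blockReward (hint k)).comp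
        (Nat.tendsto_div_const_atTop hk.ne')
    · exact tendsto_const_div_atTop_nhds_zero_nat _
  have hev := (hlim.eventually (gt_mem_nhds (show _ < δ by linarith))).and (eventually_gt_atTop 0)
  obtain ⟨M, hM⟩ := eventually_atTop.1 hev
  refine ⟨M, fun m hm => ?_⟩
  rw [Real.dist_eq, sub_zero, abs_of_nonneg (hnn m)]
  exact (hbound m (hM m hm).2).trans_lt (hM m hm).1

/-! ### From one block to the planner with logarithmic sensing range -/

theorem Planner.measurable_meanReward {m : ℕ} (A : Planner d m) (n : ℕ) :
    Measurable fun ρ => A.meanReward ρ n :=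
  (Finset.measurable_sum _ fun i _ => A.measurable_blockReward i).div_const _

theorem Planner.integrable_meanReward {m : ℕ} (A : Planner d m) (n : ℕ)
    (hint : Integrable (fun ρ => maxReward ρ 0 m) (Measure.infinitePi fun _ : Vertex d => μ)) :
    Integrable (fun ρ => A.meanReward ρ n) (Measure.infinitePi fun _ : Vertex d => μ) :=
  (integrable_finsetSum _ fun i _ =>
    (identDistrib_maxReward_position A μ i m).integrable_iff.2 hint).div_const _

/-- The `L¹` error of the planner is controlled by the `L¹` error of one iteration. -/
theorem Planner.integral_abs_meanReward_sub_le {m n : ℕ} (hm : 0 < m) (hn : 0 < n)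
    (A : Planner d m)
    (hint : Integrable (fun ρ => maxReward ρ 0 m) (Measure.infinitePi fun _ : Vertex d => μ))
    (R : ℝ) :
    ∫ ρ, |A.meanReward ρ n - R| ∂(Measure.infinitePi fun _ : Vertex d => μ) ≤
      ∫ ρ, |maxReward ρ 0 m / m - R| ∂(Measure.infinitePi fun _ : Vertex d => μ) +
        |R| * (m / n) := by
  set Q := Measure.infinitePi fun _ : Vertex d => μ with hQ
  have hm' : (0 : ℝ) < m := by exact_mod_cast hm
  have hn' : (0 : ℝ) < n := by exact_mod_cast hn
  have hNm : ((n / m : ℕ) : ℝ) * m ≤ n := by exact_mod_cast Nat.div_mul_le_self n m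
  have hNm2 : (n : ℝ) - ((n / m : ℕ) : ℝ) * m ≤ m := by
    have h1 : n ≤ n / m * m + m := by
      have := Nat.div_add_mod n m
      have := Nat.mod_lt n hm
      rw [mul_comm]; omega
    have h2 : (n : ℝ) ≤ ((n / m : ℕ) : ℝ) * m + m := by exact_mod_cast h1
    linarith
  have hdiff : Integrable (fun ρ : Vertex d → ℝ => maxReward ρ 0 m / m - R) Q :=
    (hint.div_const _).sub (integrable_const R)
  have hid : ∀ i, IdentDistrib (fun ρ => |A.blockReward i ρ / m - R|)
      (fun ρ => |maxReward ρ 0 m / m - R|) Q Q := fun i =>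
    (identDistrib_maxReward_position A μ i m).comp (u := fun x => |x / m - R|) (by fun_prop)
  have hinti : ∀ i, Integrable (fun ρ => |A.blockReward i ρ / m - R|) Q := fun i =>
    (hid i).integrable_iff.2 hdiff.abs
  have hpt : ∀ ρ, |A.meanReward ρ n - R| ≤
      (m / n) * ∑ i ∈ Finset.range (n / m), |A.blockReward i ρ / m - R| + |R| * (m / n) := by
    intro ρ
    -- The last term accounts for the fewer than `m` steps not covered by complete iterations.
    have h1 : A.meanReward ρ n - R =
        (m / n) * ∑ i ∈ Finset.range (n / m), (A.blockReward i ρ / m - R) +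
          -(R * ((n - ((n / m : ℕ) : ℝ) * m) / n)) := by
      rw [Finset.sum_sub_distrib, ← Finset.sum_div, Finset.sum_const, Finset.card_range,
        nsmul_eq_mul]
      change (∑ i ∈ Finset.range (n / m), A.blockReward i ρ) / n - R = _
      field_simp
      ring
    rw [h1]
    refine (abs_add_le _ _).trans (add_le_add ?_ ?_)
    · rw [abs_mul, abs_of_nonneg (a := (m : ℝ) / n) (by positivity)]
      gcongr
      exact Finset.abs_sum_le_sum_abs _ _
    · rw [abs_neg, abs_mul, abs_of_nonneg (a := ((n : ℝ) - _) / n)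
        (div_nonneg (by linarith) hn'.le)]
      gcongr
  have hsum : Integrable (fun ρ =>
      (m / n) * ∑ i ∈ Finset.range (n / m), |A.blockReward i ρ / m - R|) Q :=
    (integrable_finsetSum _ fun i _ => hinti i).const_mul _
  refine (integral_mono ((A.integrable_meanReward n hint).sub (integrable_const R)).abs
    (hsum.add (integrable_const _)) hpt).trans ?_
  rw [integral_add' hsum (integrable_const _), integral_const_mul,
    integral_finsetSum _ fun i _ => hinti i]
  simp only [fun i => (hid i).integral_eq, integral_const, probReal_univ, one_smul,
    Finset.sum_const, Finset.card_range, nsmul_eq_mul]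
  refine add_le_add_left ?_ _
  rw [← mul_assoc]
  refine mul_le_of_le_one_left (integral_nonneg fun _ => abs_nonneg _) ?_
  rw [div_mul_eq_mul_div, div_le_one hn', mul_comm]
  exact hNm

theorem tendsto_floor_log : Tendsto (fun n : ℕ => ⌊1 * Real.log n⌋₊) atTop atTop := by
  simp only [one_mul]
  exact tendsto_nat_floor_atTop.comp (Real.tendsto_log_atTop.comp tendsto_natCast_atTop_atTop)

theorem tendsto_floor_log_div :
    Tendsto (fun n : ℕ => (⌊1 * Real.log n⌋₊ : ℝ) / n) atTop (𝓝 0) := by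
  have h : Tendsto (fun n : ℕ => Real.log n / n) atTop (𝓝 0) :=
    Real.isLittleO_log_id_atTop.tendsto_div_nhds_zero.comp tendsto_natCast_atTop_atTop
  refine tendsto_of_tendsto_of_tendsto_of_le_of_le tendsto_const_nhds h
    (fun n => by positivity) fun n => ?_
  simp only [one_mul]
  gcongr
  exact Nat.floor_le (Real.log_natCast_nonneg n)

theorem tendsto_integral_abs_meanReward_sub (hd : 0 < d)
    (hint : ∀ n, Integrable (fun ρ => maxReward ρ 0 n) (Measure.infinitePi fun _ : Vertex d => μ))
    {R : ℝ} (hR : Tendsto (fun n : ℕ =>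
      (∫ ρ, maxReward ρ 0 n ∂(Measure.infinitePi fun _ : Vertex d => μ)) / n) atTop (𝓝 R))
    (A : ∀ m : ℕ, Planner d m) :
    Tendsto (fun n : ℕ => ∫ ρ, |(A ⌊1 * Real.log n⌋₊).meanReward ρ n - R|
      ∂(Measure.infinitePi fun _ : Vertex d => μ)) atTop (𝓝 0) := by
  have h1 := ((tendsto_integral_abs_maxReward_div_sub hd hint hR).comp tendsto_floor_log).add
    (tendsto_floor_log_div.const_mul |R|)
  rw [mul_zero, add_zero] at h1
  refine tendsto_of_tendsto_of_tendsto_of_le_of_le' tendsto_const_nhds h1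
    (Eventually.of_forall fun n => integral_nonneg fun _ => abs_nonneg _) ?_
  filter_upwards [eventually_gt_atTop 0, tendsto_floor_log.eventually_gt_atTop 0] with n hn hm
  exact (A _).integral_abs_meanReward_sub_le hm hn (hint _) R

end Limit

end LatticePlanning

theorem mainTheorem1 (d : ℕ) (hd : 0 < d) (μ : Measure ℝ) [IsProbabilityMeasure μ]
    (hneg : Integrable (fun x : ℝ => max (-x) 0) μ)
    (htail : IntegrableOn (fun s : ℝ => (1 - cdf μ s) ^ (1 / (d : ℝ))) (Set.Ioi 0)) :
    ∃ c : ℝ, 0 < c ∧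
      ∀ (Ω : Type u) [MeasurableSpace Ω] (P : Measure Ω) [IsProbabilityMeasure P]
        (r : LatticePlanning.Vertex d → Ω → ℝ),
        (∀ v, Measurable (r v)) → (∀ v, P.map (r v) = μ) → iIndepFun r P →
        (∀ n : ℕ, Integrable (fun ω => LatticePlanning.maxReward (fun v => r v ω) 0 n) P) ∧
        Tendsto (fun n : ℕ => (∫ ω, LatticePlanning.maxReward (fun v => r v ω) 0 n ∂P) / n) atTop
          (𝓝 (LatticePlanning.optimalMeanReward P r)) ∧
        ∀ (A : ∀ m : ℕ, LatticePlanning.Planner d m) (δ : ℝ), 0 < δ →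
          Tendsto (fun n : ℕ => P {ω | δ ≤
              |(A ⌊c * Real.log n⌋₊).meanReward (fun v => r v ω) n
                - LatticePlanning.optimalMeanReward P r|}) atTop (𝓝 0) := by
  -- Only `m → ∞` and `m / n → 0` matter for the sensing range, so `c = 1` serves for every `d` and
  -- `μ`.
  refine ⟨1, one_pos, fun Ω _ P _ r hr hlaw hind => ?_⟩
  have hint := LatticePlanning.integrable_maxReward_zero hd hneg htail
  obtain ⟨R, hR⟩ := LatticePlanning.exists_tendsto_integral_maxReward hd hneg htail
  have hmeas : Measurable fun (ω : Ω) (v : LatticePlanning.Vertex d) => r v ω :=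
    measurable_pi_lambda _ hr
  -- The joint law of the rewards is the product measure, to which all statements are transferred.
  have hmap : P.map (fun ω v => r v ω) =
      Measure.infinitePi fun _ : LatticePlanning.Vertex d => μ := by
    rw [hind.map_fun_eq_infinitePi_map hr]
    simp only [hlaw]
  have hmp : MeasurePreserving (fun (ω : Ω) (v : LatticePlanning.Vertex d) => r v ω) P
      (Measure.infinitePi fun _ : LatticePlanning.Vertex d => μ) := ⟨hmeas, hmap⟩
  have hintegral : ∀ n : ℕ, ∫ ω, LatticePlanning.maxReward (fun v => r v ω) 0 n ∂P =
      ∫ ρ, LatticePlanning.maxReward ρ 0 n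
        ∂(Measure.infinitePi fun _ : LatticePlanning.Vertex d => μ) := fun n => by
    rw [← hmap, integral_map hmeas.aemeasurable
      (LatticePlanning.measurable_maxReward 0 n).aestronglyMeasurable]
  have hlim : Tendsto (fun n : ℕ => (∫ ω, LatticePlanning.maxReward (fun v => r v ω) 0 n ∂P) / n)
      atTop (𝓝 R) := by
    simpa only [hintegral] using hR
  have hopt : LatticePlanning.optimalMeanReward P r = R := hlim.limUnder_eq
  rw [hopt]
  refine ⟨fun n => hmp.integrable_comp_of_integrable (hint n), hlim, fun A δ hδ => ?_⟩
  have hconv := LatticePlanning.tendsto_integral_abs_meanReward_sub hd hint hR A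
  have hsmall := ENNReal.tendsto_ofReal (hconv.div_const δ)
  rw [zero_div, ENNReal.ofReal_zero] at hsmall
  refine tendsto_of_tendsto_of_tendsto_of_le_of_le tendsto_const_nhds hsmall
    (fun _ => zero_le) fun n => ?_
  have hset : MeasurableSet {ρ : LatticePlanning.Vertex d → ℝ | δ ≤
      |(A ⌊1 * Real.log n⌋₊).meanReward ρ n - R|} :=
    measurableSet_le measurable_const
      (((A _).measurable_meanReward n).sub_const R).abs
  have hpre := hmp.measure_preimage hset.nullMeasurableSet
  refine hpre.le.trans ?_
  rw [← ofReal_measureReal]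
  refine ENNReal.ofReal_le_ofReal ((le_div_iff₀' hδ).2 ?_)
  exact mul_meas_ge_le_integral_of_nonneg (ae_of_all _ fun _ => abs_nonneg _)
    (((A _).integrable_meanReward n (hint _)).sub (integrable_const R)).abs δ
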